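/- **Proposition ($q$-difference equations for the first column of $Y_n$).** Let $0<q<1$, let $\alpha,\beta>-1$ be real with $\alpha-\beta\notin\mathbb Z$, and let $n\ge 1$. Write $(a;q)_\infty=\prod_{j\ge 0}(1-aq^j)$ and $\int_0^1 f(x)\,d_qx=\sum_{k\ge 0}f(q^k)q^k$, and let $w_1(x)=x^\alpha(qx;q)_\infty$, $w_2(x)=x^\beta(qx;q)_\infty$. For $(k,m)\in\{(n,n),(n-1,n),(n,n-1)\}$ there is exactly one monic polynomial $P_{k,m}$ of degree $k+m$ with $\int_0^1P_{k,m}(x)x^iw_1(x)\,d_qx=0$ for $0\le i<k$ and $\int_0^1P_{k,m}(x)x^jw_2(x)\,d_qx=0$ for $0\le j<m$. The constants $\gamma_1^{(n-1,n)}=\int_0^1P_{n-1,n}(x)x^{n-1}w_1(x)\,d_qx$ and $\gamma_2^{(n,n-1)}=\int_0^1P_{n,n-1}(x)x^{n-1}w_2(x)\,d_qx$ are non-zero. Put $$Y_{1,1}=P_{n,n},\qquad Y_{2,1}=P_{n-1,n}/\gamma_1^{(n-1,n)},\qquad Y_{3,1}=P_{n,n-1}/\gamma_2^{(n,n-1)}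 .$$ (a) For every $t\in\mathbb C$, the function $y(t)=Y_{1,1}(tq^{2n})(q^{2n+1}t;q)_\infty$ satisfies $$y(t)=[1+q^\alpha+q^\beta-qt]\,y(qt)+[-(q^\alpha+q^\beta+q^{\alpha+\beta})+(q^\alpha+q^\beta)q^{n+2}t]\,y(q^2t)+[q^{\alpha+\beta}-q^{3+\alpha+\beta+2n}t]\,y(q^3t),$$ the function $y(t)=Y_{2,1}(tq^{2n})(q^{2n+1}t;q)_\infty$ satisfies $$y(t)=[1+q^\alpha+q^\beta-q^2t]\,y(qt)+[-(q^\alpha+q^\beta+q^{\alpha+\beta})+(q^\alpha+q^{\beta+1})q^{n+2}t]\,y(q^2t)+[q^{\alpha+\beta}-q^{3+\alpha+\beta+2n}t]\,y(q^3t),$$ and the function $y(t)=Y_{3,1}(tq^{2n})(q^{2n+1}t;q)_\infty$ satisfies $$y(t)=[1+q^\alpha+q^\beta-q^2t]\,y(qt)+[-(q^\alpha+q^\beta+q^{\alpha+\beta})+(q^{\alpha+1}+q^\beta)q^{n+2}t]\,y(q^2t)+[q^{\alpha+\beta}-q^{3+\alpha+\beta+2n}t]\,y(q^3t).$$ (b)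 Suppose in addition that $\alpha,\beta\notin\mathbb Z$. For $\delta\in\{\alpha,\beta\}$ let $h_\delta$ be meromorphic on $\mathbb C\setminus\{0\}$ with simple poles exactly at the points $q^k$ ($k\in\mathbb Z$), with $h_\delta(qz)=q^\delta h_\delta(z)$ and residue $1$ at $z=1$. Let $\Gamma$ be a rectifiable Jordan curve whose interior contains $0$ and all $q^k$, $k\ge 0$, and whose exterior contains all $q^k$, $k<0$. Let the $3\times 3$ matrix function $Y$ solve the following Riemann–Hilbert problem: $Y$ is analytic on $\mathbb C\setminus\Gamma$; it has continuous boundary values $Y_-$, $Y_+$ on $\Gamma$ from the interior and the exterior, with $$Y_+(s)=Y_-(s)\begin{pmatrix}1&(qs;q)_\infty h_\alpha(s)&(qs;q)_\infty h_\beta(s)\\0&1&0\\0&0&1\end{pmatrix}\quad(s\in\Gamma);$$ and $Y(z)\,\mathrm{diag}(z^{-2n},z^n,z^n)=I+\mathcal O(1/z)$ as $|z|\to\infty$. Then on $\mathbb C\setminus\Gamma$ the first column of $Y$ is $(Y_{1,1},Y_{2,1},Y_{3,1})^{T}$ as above. So the entries of the first column of $Y$, extended across $\Gamma$ by these polynomials,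 satisfy the equations in (a). -/

import Mathlib

open Filter Topology

noncomputable section

/-- The infinite `q`-Pochhammer symbol `(a; q)_∞ = ∏_{j ≥ 0} (1 - a q^j)`. -/
def qPochInf (q : ℝ) (a : ℂ) : ℂ := ∏' j : ℕ, (1 - a * (q : ℂ) ^ j)

/-- The un-normalised Jackson integral `∫_0^1 f(x) d_q x = ∑_{k ≥ 0} f(q^k) q^k`. -/
def jacksonIntegral (q : ℝ) (f : ℝ → ℂ) : ℂ := ∑' k : ℕ, f (q ^ k) * (q : ℂ) ^ k

/-- The multiple little `q`-Jacobi weight `x^α (q x; q)_∞`. -/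
def littleJacobiWeight (q α : ℝ) (x : ℝ) : ℂ :=
  ((x ^ α : ℝ) : ℂ) * qPochInf q ((q : ℂ) * (x : ℂ))

/-- `P` is the monic multiple `q`-orthogonal polynomial `P_{n,m}` (type II, of degree `n + m`)
for the pair of weights `w₁ d_q x`, `w₂ d_q x`. -/
structure IsMultipleOrthogonal (q : ℝ) (w₁ w₂ : ℝ → ℂ) (n m : ℕ) (P : Polynomial ℂ) :
    Prop where
  monic : P.Monic
  natDegree_eq : P.natDegree = n + m
  orthogonal_left : ∀ k < n,
    jacksonIntegral q (fun x => P.eval (x : ℂ) * (x : ℂ) ^ k * w₁ x) = 0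
  orthogonal_right : ∀ j < m,
    jacksonIntegral q (fun x => P.eval (x : ℂ) * (x : ℂ) ^ j * w₂ x) = 0

/-- The set of points `z ≠ 0` that do not lie on the full lattice `q^ℤ`. -/
def offLattice (q : ℝ) : Set ℂ := {z | z ≠ 0 ∧ ∀ k : ℤ, z ≠ (q : ℂ) ^ k}

/-- `h` is the function `h_α`: meromorphic on `ℂ \ {0}`, with simple poles located exactly at the
points `q^k` (`k ∈ ℤ`), with `h (q z) = q^α h z`, and normalised to have residue `1` at `z = 1`.
(Its residue at `q^k` is then `q^{k (1 + α)}`.) -/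
structure IsQPeriodicKernel (q α : ℝ) (h : ℂ → ℂ) : Prop where
  differentiableOn : DifferentiableOn ℂ h (offLattice q)
  simple_pole : ∀ k : ℤ, meromorphicOrderAt h ((q : ℂ) ^ k) = ((-1 : ℤ) : WithTop ℤ)
  map_mul : ∀ z ∈ offLattice q, h ((q : ℂ) * z) = ((q ^ α : ℝ) : ℂ) * h z
  residue_one : Tendsto (fun z => (z - 1) * h z) (𝓝[≠] (1 : ℂ)) (𝓝 1)

/-- A rectifiable Jordan curve in the plane: the image of the unit circle under an injective
Lipschitz map. -/
def IsRectifiableJordanCurve (Γ : Set ℂ) : Prop :=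
  ∃ γ : Circle → ℂ, (∃ K : NNReal, LipschitzWith K γ) ∧ Function.Injective γ ∧ Set.range γ = Γ

/-- The interior `𝒟₋` of a closed curve: the union of the bounded components of its complement. -/
def curveInterior (Γ : Set ℂ) : Set ℂ :=
  {z | z ∉ Γ ∧ Bornology.IsBounded (connectedComponentIn Γᶜ z)}

/-- The exterior `𝒟₊` of a closed curve: the union of the unbounded components of its
complement. -/
def curveExterior (Γ : Set ℂ) : Set ℂ :=
  {z | z ∉ Γ ∧ ¬ Bornology.IsBounded (connectedComponentIn Γᶜ z)}

/-- An appropriate curve: a rectifiable Jordan curve whose interior contains `0` and all `q^k`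
with `k ≥ 0`, and whose exterior contains all `q^k` with `k < 0`. -/
structure IsAppropriateCurve (q : ℝ) (Γ : Set ℂ) : Prop where
  jordan : IsRectifiableJordanCurve Γ
  zero_mem : (0 : ℂ) ∈ curveInterior Γ
  mem_interior : ∀ k : ℤ, 0 ≤ k → (q : ℂ) ^ k ∈ curveInterior Γ
  mem_exterior : ∀ k : ℤ, k < 0 → (q : ℂ) ^ k ∈ curveExterior Γ

/-- The jump matrix of the Riemann-Hilbert problem; `w(s) = (q s; q)_∞`. -/
def jumpMatrix (q : ℝ) (h₁ h₂ : ℂ → ℂ) (s : ℂ) : Matrix (Fin 3) (Fin 3) ℂ :=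
  !![1, qPochInf q ((q : ℂ) * s) * h₁ s, qPochInf q ((q : ℂ) * s) * h₂ s;
     0, 1, 0;
     0, 0, 1]

/-- `Y` solves the `3 × 3` Riemann-Hilbert problem of index `n` on the curve `Γ`.  The values of
`Y` on `Γ` itself are irrelevant; `Yminus` and `Yplus` are its boundary values from the interior
and from the exterior. -/
structure SolvesRHP (q : ℝ) (h₁ h₂ : ℂ → ℂ) (n : ℕ) (Γ : Set ℂ)
    (Y : ℂ → Matrix (Fin 3) (Fin 3) ℂ) : Prop where
  analytic : ∀ i j, DifferentiableOn ℂ (fun z => Y z i j) Γᶜ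
  jump : ∃ Yminus Yplus : ℂ → Matrix (Fin 3) (Fin 3) ℂ,
    ContinuousOn Yminus Γ ∧ ContinuousOn Yplus Γ ∧
    ∀ s ∈ Γ, Tendsto Y (𝓝[curveInterior Γ] s) (𝓝 (Yminus s)) ∧
      Tendsto Y (𝓝[curveExterior Γ] s) (𝓝 (Yplus s)) ∧
      Yplus s = Yminus s * jumpMatrix q h₁ h₂ s
  decay : ∀ i j,
    (fun z : ℂ => (Y z * Matrix.diagonal ![z ^ (-(2 * (n : ℤ))), z ^ n, z ^ n] - 1) i j)
      =O[Bornology.cobounded ℂ] (fun z : ℂ => z⁻¹)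

/-- The function `t ↦ f (t q^{2n}) (q^{2n+1} t; q)_∞` attached to an entry `f`. -/
def rescaledEntry (q : ℝ) (n : ℕ) (f : ℂ → ℂ) (t : ℂ) : ℂ :=
  f (t * (q : ℂ) ^ (2 * n)) * qPochInf q ((q : ℂ) ^ (2 * n + 1) * t)

end

/-!
With `a = q^α`, `b = q^β`, the moments of `x^α (q x; q)_∞` satisfy a two-term recurrence: the
generating function `M(u) = ∑ u^k (q^{k+1}; q)_∞` obeys `M(q u) = (1 - u) M(u)` (`momentGen_mul`),
so the `s`-th moment is `(a q; q)_s M(a q)`, and `M(a q) ≠ 0`. Let `T` be the linear map with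
`T(x^s) = (u; q)_s` (`qMellin`). It preserves degrees, and the Jackson integral of `P(x) x^i`
against the weight is a non-zero multiple of `(T P)(a q^{i+1})` (`hasSum_jackson`). Multiple
orthogonality of `P` of index `(k, m)` therefore says that `T P` vanishes at the `k + m` distinct
points `a q^{i+1}`, `b q^{j+1}`, that is, `T P = c ∏ (u - a q^{i+1}) ∏ (u - b q^{j+1})`
(`qMellin_eq_of_orthogonal`). Existence, uniqueness and `γ₁ γ₂ ≠ 0` follow at once.

Under `T`, multiplication by `x` becomes `F(u) ↦ (1 - u) F(q u)`, and multiplication by `u` comes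
from the operator `U P(x) = (1 - x) P(x / q)`. The product formula for `F = T P` gives
`(u - a q^k) (u - b q^m) F(q u) = q^{k+m} (u - a) (u - b) F(u)`, which translates into
`(U - a q^k) (U - b q^m) x P = q^{k+m} (U - a) (U - b) (1 - U) P` (`backwardOp_relation`). After
multiplication by `(q x; q)_∞` the operator `U` is the shift `x ↦ x / q`, and this is the
`q`-difference equation.

For the Riemann-Hilbert problem, the first column has no jump. A rectifiable curve is removable for
continuous functions (`IsRectifiableJordanCurve.differentiableOn`: by Morera's theorem, cutting a
rectangle into `N × N` cells of which only `O(N)` meet the curve), so the entries of the first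
column are entire of polynomial growth, hence polynomials. This needs no case of the Jordan curve
theorem, since interior and exterior exhaust the complement of the curve by definition. In the
second and third columns, adding `(q z; q)_∞ h P` in the interior removes the jump and produces a
function holomorphic off `{0} ∪ q^ℕ`, whose residues at the points `q^k` are the terms of a Jackson
integral of `P`. Comparing circles around `0` of radius tending to `0` and to `∞` evaluates the sum
(`jacksonIntegral_eq_of_jump`), which gives the orthogonality relations and the normalisation.
-/

noncomputable section

/-! ### The infinite `q`-Pochhammer symbol -/

lemma summable_norm_mul_pow {q : ℝ} (hq0 : 0 < q) (hq1 : q < 1) (a : ℂ) :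
    Summable fun j : ℕ => ‖-(a * (q : ℂ) ^ j)‖ := by
  simp only [norm_neg, norm_mul, norm_pow, Complex.norm_real, Real.norm_eq_abs, abs_of_pos hq0]
  exact (summable_geometric_of_lt_one hq0.le hq1).mul_left _

lemma qPochInf_eq_one_sub_mul {q : ℝ} (hq0 : 0 < q) (hq1 : q < 1) (a : ℂ) :
    qPochInf q a = (1 - a) * qPochInf q ((q : ℂ) * a) := by
  have h : Multipliable fun j : ℕ => 1 - (q * a) * (q : ℂ) ^ j := by
    simpa [sub_eq_add_neg] using
      multipliable_one_add_of_summable (summable_norm_mul_pow hq0 hq1 (q * a))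
  have h' : Multipliable fun j : ℕ => 1 - a * (q : ℂ) ^ (j + 1) :=
    h.congr fun j => by ring
  have h2 := tprod_eq_zero_mul' (f := fun j : ℕ => 1 - a * (q : ℂ) ^ j) h'
  have h3 : ∏' j : ℕ, (1 - a * (q : ℂ) ^ (j + 1)) = qPochInf q (q * a) :=
    tprod_congr fun j => by ring
  rw [h3, pow_zero, mul_one] at h2
  exact h2

lemma qPochInf_ne_zero {q : ℝ} (hq0 : 0 < q) (hq1 : q < 1) {a : ℂ}
    (ha : ∀ j : ℕ, a * (q : ℂ) ^ j ≠ 1) : qPochInf q a ≠ 0 := by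
  have := tprod_one_add_ne_zero_of_summable (f := fun j : ℕ => -(a * (q : ℂ) ^ j))
    (fun j h => ha j (by linear_combination -h)) (summable_norm_mul_pow hq0 hq1 a)
  simpa [qPochInf, sub_eq_add_neg] using this

lemma differentiable_qPochInf {q : ℝ} (hq0 : 0 < q) (hq1 : q < 1) :
    Differentiable ℂ (qPochInf q) := by
  intro z
  have hz : z ∈ Metric.ball (0 : ℂ) (‖z‖ + 1) := by simp
  have hP : HasProdLocallyUniformlyOn (fun (j : ℕ) (x : ℂ) => 1 + -(x * (q : ℂ) ^ j))
      (fun x => ∏' j : ℕ, (1 + -(x * (q : ℂ) ^ j))) (Metric.ball (0 : ℂ) (‖z‖ + 1)) := by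
    refine Summable.hasProdLocallyUniformlyOn_nat_one_add Metric.isOpen_ball
      ((summable_geometric_of_lt_one hq0.le hq1).mul_left (‖z‖ + 1))
      (.of_forall fun j x hx => ?_) (fun j => by fun_prop)
    simp only [norm_neg, norm_mul, norm_pow, Complex.norm_real, Real.norm_eq_abs, abs_of_pos hq0]
    have : ‖x‖ ≤ ‖z‖ + 1 := by simpa using (Metric.mem_ball.1 hx).le
    gcongr
  have hd : DifferentiableOn ℂ (fun x : ℂ => ∏' j : ℕ, (1 + -(x * (q : ℂ) ^ j)))
      (Metric.ball (0 : ℂ) (‖z‖ + 1)) :=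
    hP.differentiableOn (.of_forall fun _ => by
      simpa [Finset.prod_fn] using DifferentiableOn.finsetProd (fun _ _ => by fun_prop))
      Metric.isOpen_ball
  have := hd.differentiableAt (Metric.isOpen_ball.mem_nhds hz)
  have he : qPochInf q = fun x : ℂ => ∏' j : ℕ, (1 + -(x * (q : ℂ) ^ j)) := by
    funext x
    simp only [qPochInf, sub_eq_add_neg]
  rw [he]
  exact this

lemma exists_norm_qPochInf_pow_le {q : ℝ} (hq0 : 0 < q) (hq1 : q < 1) :
    ∃ B, ∀ k : ℕ, ‖qPochInf q (q * (q : ℂ) ^ k)‖ ≤ B := by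
  have h1 : Tendsto (fun k : ℕ => (q : ℂ) * (q : ℂ) ^ k) atTop (𝓝 (q * 0)) := by
    refine (tendsto_pow_atTop_nhds_zero_of_norm_lt_one ?_).const_mul _
    simpa [abs_of_pos hq0] using hq1
  have h2 := ((differentiable_qPochInf hq0 hq1).continuous.tendsto _).comp h1
  obtain ⟨B, hB⟩ := h2.norm.bddAbove_range
  exact ⟨B, fun k => hB ⟨k, rfl⟩⟩

/-! ### Moments of the weights -/

/-- The generating function `u ↦ ∑_k u^k (q^{k+1}; q)_∞`. At `u = q^{α + s + 1}` it is the
`s`-th moment of the weight `x^α (q x; q)_∞` with respect to the Jackson integral. -/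
def momentGen (q : ℝ) (u : ℂ) : ℂ := ∑' k : ℕ, u ^ k * qPochInf q (q * (q : ℂ) ^ k)

lemma summable_momentGen {q : ℝ} (hq0 : 0 < q) (hq1 : q < 1) {u : ℂ} (hu : ‖u‖ < 1) :
    Summable fun k : ℕ => u ^ k * qPochInf q (q * (q : ℂ) ^ k) := by
  obtain ⟨B, hB⟩ := exists_norm_qPochInf_pow_le hq0 hq1
  refine Summable.of_norm_bounded
    ((summable_geometric_of_lt_one (norm_nonneg u) hu).mul_right B) fun k => ?_
  rw [norm_mul, norm_pow]
  gcongr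
  exact hB k

lemma momentGen_mul {q : ℝ} (hq0 : 0 < q) (hq1 : q < 1) {u : ℂ} (hu : ‖u‖ < 1) :
    momentGen q (u * q) = (1 - u) * momentGen q u := by
  have hqn : ‖(q : ℂ)‖ < 1 := by simpa [abs_of_pos hq0] using hq1
  have huq : ‖u * q‖ < 1 := by
    rw [norm_mul]; nlinarith [norm_nonneg u, norm_nonneg (q : ℂ)]
  have hs := summable_momentGen hq0 hq1 hu
  have hs' := summable_momentGen hq0 hq1 huq
  -- `M(u) - M(uq) = ∑ u^k (1 - q^k) (q^{k+1}; q)_∞ = ∑ u^k (q^k; q)_∞`, whose `k = 0` term is zero.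
  have key : momentGen q u - momentGen q (u * q) = u * momentGen q u := by
    rw [momentGen, momentGen, ← hs.tsum_sub hs', (hs.sub hs').tsum_eq_zero_add, ← tsum_mul_left]
    simp only [pow_zero, sub_self, zero_add]
    refine tsum_congr fun k => ?_
    rw [qPochInf_eq_one_sub_mul hq0 hq1 (q * (q : ℂ) ^ k)]
    ring_nf
  linear_combination -key

lemma norm_mul_pow_lt_one {q : ℝ} (hq0 : 0 < q) (hq1 : q < 1) {u : ℂ} (hu : ‖u‖ < 1) (s : ℕ) :
    ‖u * (q : ℂ) ^ s‖ < 1 := by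
  rw [norm_mul, norm_pow, Complex.norm_real, Real.norm_eq_abs, abs_of_pos hq0]
  calc ‖u‖ * q ^ s ≤ ‖u‖ * 1 := by
        gcongr
        exact pow_le_one₀ hq0.le hq1.le
    _ < 1 := by simpa using hu

lemma momentGen_mul_pow {q : ℝ} (hq0 : 0 < q) (hq1 : q < 1) {u : ℂ} (hu : ‖u‖ < 1) (s : ℕ) :
    momentGen q (u * (q : ℂ) ^ s) =
      (∏ i ∈ Finset.range s, (1 - u * (q : ℂ) ^ i)) * momentGen q u := by
  induction s with
  | zero => simp
  | succ s ih =>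
    rw [pow_succ, ← mul_assoc, momentGen_mul hq0 hq1 (norm_mul_pow_lt_one hq0 hq1 hu s), ih,
      Finset.prod_range_succ]
    ring

/-- If `M(u)` vanished, so would every `M(u q^s)`, and hence the limit `M(0) = (q; q)_∞`. -/
lemma momentGen_ne_zero {q : ℝ} (hq0 : 0 < q) (hq1 : q < 1) {u : ℂ} (hu : ‖u‖ < 1) :
    momentGen q u ≠ 0 := by
  intro h0
  have hqn : ‖(q : ℂ)‖ < 1 := by simpa [abs_of_pos hq0] using hq1
  obtain ⟨B, hB⟩ := exists_norm_qPochInf_pow_le hq0 hq1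
  have hu0 : Tendsto (fun s : ℕ => u * (q : ℂ) ^ s) atTop (𝓝 0) := by
    simpa using (tendsto_pow_atTop_nhds_zero_of_norm_lt_one hqn).const_mul u
  have hlim : Tendsto (fun s : ℕ => momentGen q (u * (q : ℂ) ^ s)) atTop
      (𝓝 (∑' k : ℕ, (0 : ℂ) ^ k * qPochInf q (q * (q : ℂ) ^ k))) := by
    refine tendsto_tsum_of_dominated_convergence
      (bound := fun k => ‖u‖ ^ k * B)
      ((summable_geometric_of_lt_one (norm_nonneg u) hu).mul_right B) (fun k => ?_)
      (.of_forall fun s k => ?_)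
    · exact (hu0.pow k).mul_const _
    · rw [norm_mul, norm_pow, norm_mul, norm_pow]
      gcongr
      · exact mul_le_of_le_one_right (norm_nonneg u) (pow_le_one₀ (norm_nonneg _) hqn.le)
      · exact hB k
  have hz : (fun s : ℕ => momentGen q (u * (q : ℂ) ^ s)) = fun _ => 0 := by
    funext s
    rw [momentGen_mul_pow hq0 hq1 hu, h0, mul_zero]
  rw [hz, tsum_eq_single 0 (fun k hk => by simp [hk])] at hlim
  have := tendsto_nhds_unique hlim tendsto_const_nhds
  refine qPochInf_ne_zero hq0 hq1 (a := (q : ℂ)) (fun j h => ?_) (by simpa using this)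
  have h1 : q * q ^ j = 1 := by exact_mod_cast h
  have h2 : q ^ j ≤ 1 := pow_le_one₀ hq0.le hq1.le
  nlinarith

/-! ### The `q`-Mellin transform on polynomials -/

section Polynomials

open Polynomial

/-- The finite `q`-Pochhammer symbol `(u; q)_s` as a polynomial in `u`. -/
def qPochPoly (q : ℂ) (s : ℕ) : ℂ[X] := ∏ i ∈ Finset.range s, (1 - C (q ^ i) * X)

/-- The linear map on polynomials sending `x^s` to `(u; q)_s`. Up to a constant its value at
`u = q^{α + i + 1}` is the Jackson integral of `P(x) x^i` against `x^α (q x; q)_∞`. -/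
def qMellin (q : ℂ) : ℂ[X] →ₗ[ℂ] ℂ[X] :=
  Polynomial.lsum fun s => LinearMap.toSpanSingleton ℂ ℂ[X] (qPochPoly q s)

lemma qMellin_eq_sum (q : ℂ) (P : ℂ[X]) :
    qMellin q P = P.sum fun s c => c • qPochPoly q s := by
  simp [qMellin, Polynomial.lsum_apply]

lemma qMellin_monomial (q : ℂ) (s : ℕ) (c : ℂ) :
    qMellin q (monomial s c) = c • qPochPoly q s := by
  rw [qMellin_eq_sum, Polynomial.sum_monomial_index _ _ (by simp)]

lemma qPochPoly_succ (q : ℂ) (s : ℕ) :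
    qPochPoly q (s + 1) = qPochPoly q s * (1 - C (q ^ s) * X) := Finset.prod_range_succ _ _

lemma qPochPoly_succ' (q : ℂ) (s : ℕ) :
    qPochPoly q (s + 1) = (1 - X) * (qPochPoly q s).comp (C q * X) := by
  rw [qPochPoly, Finset.prod_range_succ', qPochPoly, Polynomial.prod_comp, mul_comm]
  congr 1
  · simp
  · refine Finset.prod_congr rfl fun i _ => ?_
    simp [pow_succ, mul_assoc]

lemma degree_qPochPoly {q : ℂ} (hq : q ≠ 0) (s : ℕ) : (qPochPoly q s).degree = s := by
  induction s with
  | zero => simp [qPochPoly]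
  | succ s ih =>
    have h : (1 - C (q ^ s) * X : ℂ[X]) = C (-(q ^ s)) * X + C 1 := by
      simp; ring
    rw [qPochPoly_succ, degree_mul, ih, h, degree_linear (by simp [hq])]
    norm_cast

/-- The monomials and the `(u; q)_s` are both graded bases, so the transform preserves degrees. -/
lemma degree_qMellin {q : ℂ} (hq : q ≠ 0) (P : ℂ[X]) : (qMellin q P).degree = P.degree := by
  induction hn : P.support.card using Nat.strong_induction_on generalizing P with
  | _ m ih =>
    rcases eq_or_ne P 0 with rfl | hP
    · simp
    · have h1 := ih _ (hn ▸ eraseLead_support_card_lt hP) P.eraseLead rfl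
      have h2 : qMellin q P = qMellin q P.eraseLead +
          P.leadingCoeff • qPochPoly q P.natDegree := by
        rw [← qMellin_monomial, ← map_add, eraseLead_add_monomial_natDegree_leadingCoeff]
      have h3 : (P.leadingCoeff • qPochPoly q P.natDegree).degree = P.degree := by
        rw [smul_eq_C_mul, degree_C_mul (leadingCoeff_ne_zero.2 hP), degree_qPochPoly hq,
          degree_eq_natDegree hP]
      rw [h2, degree_add_eq_right_of_degree_lt, h3]
      rw [h1, h3]
      exact degree_eraseLead_lt hP

/-- Multiplication by `x` becomes `F(u) ↦ (1 - u) F(q u)`. -/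
lemma qMellin_X_mul (q : ℂ) (P : ℂ[X]) :
    qMellin q (X * P) = (1 - X) * (qMellin q P).comp (C q * X) := by
  induction P using Polynomial.induction_on' with
  | add P Q hP hQ => simp only [mul_add, map_add, hP, hQ, add_comp]
  | monomial s c =>
    rw [X_mul_monomial, qMellin_monomial, qMellin_monomial, qPochPoly_succ', smul_comp,
      mul_smul_comm]

/-- The backward operator `P(x) ↦ (1 - x) P(x / q)`, to which the `q`-Mellin transform associates
multiplication by `u`. After multiplication by `(q x; q)_∞` it becomes the plain shift
`x ↦ x / q`. -/
def backwardOp (q : ℂ) : ℂ[X] →ₗ[ℂ] ℂ[X] where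
  toFun P := (1 - X) * P.comp (C q⁻¹ * X)
  map_add' P Q := by simp [mul_add]
  map_smul' c P := by simp

lemma qMellin_backwardOp {q : ℂ} (hq : q ≠ 0) (P : ℂ[X]) :
    qMellin q (backwardOp q P) = X * qMellin q P := by
  induction P using Polynomial.induction_on' with
  | add P Q hP hQ => simp only [mul_add, map_add, hP, hQ]
  | monomial s c =>
    have h1 : backwardOp q (monomial s c) =
        monomial s (c * q⁻¹ ^ s) - monomial (s + 1) (c * q⁻¹ ^ s) := by
      simp only [backwardOp, LinearMap.coe_mk, AddHom.coe_mk, ← C_mul_X_pow_eq_monomial, mul_comp,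
        C_comp, X_pow_comp, mul_pow, map_mul, map_pow]
      ring
    have h2 : (C (q⁻¹ ^ s) * C (q ^ s) : ℂ[X]) = 1 := by
      rw [← C_mul, ← mul_pow, inv_mul_cancel₀ hq, one_pow, C_1]
    rw [h1, map_sub, qMellin_monomial, qMellin_monomial, qMellin_monomial, qPochPoly_succ]
    simp only [smul_eq_C_mul, C_mul]
    linear_combination (C c * qPochPoly q s * X) * h2

lemma qMellin_injective {q : ℂ} (hq : q ≠ 0) : Function.Injective (qMellin q) := by
  rw [injective_iff_map_eq_zero]
  intro P hP
  rw [← degree_eq_bot, ← degree_qMellin hq, hP, degree_zero]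

lemma eval_qPochPoly (q u : ℂ) (s : ℕ) :
    (qPochPoly q s).eval u = ∏ i ∈ Finset.range s, (1 - u * q ^ i) := by
  rw [qPochPoly, eval_prod]
  exact Finset.prod_congr rfl fun i _ => by simp [mul_comm]

/-- The moments of `x^α (q x; q)_∞` are given by the `q`-Mellin transform; here `a = q^α`. -/
lemma hasSum_jackson {q : ℝ} (hq0 : 0 < q) (hq1 : q < 1) {a : ℂ} (ha : ‖a * q‖ < 1)
    (i : ℕ) (P : ℂ[X]) :
    HasSum (fun k : ℕ => P.eval ((q : ℂ) ^ k) * ((q : ℂ) ^ k) ^ i *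
        (a ^ k * qPochInf q (q * (q : ℂ) ^ k)) * (q : ℂ) ^ k)
      (momentGen q (a * (q : ℂ) ^ (i + 1)) * (qMellin q P).eval (a * (q : ℂ) ^ (i + 1))) := by
  have hu : ‖a * (q : ℂ) ^ (i + 1)‖ < 1 := by
    rw [pow_succ', ← mul_assoc]
    exact norm_mul_pow_lt_one hq0 hq1 ha i
  induction P using Polynomial.induction_on' with
  | add P Q hP hQ =>
    simp only [map_add, eval_add, mul_add]
    refine (hP.add hQ).congr_fun fun k => ?_
    ring
  | monomial s c =>
    have h := (summable_momentGen hq0 hq1 (norm_mul_pow_lt_one hq0 hq1 hu s)).hasSum.mul_left c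
    rw [← momentGen, momentGen_mul_pow hq0 hq1 hu s, ← eval_qPochPoly] at h
    rw [qMellin_monomial]
    have hr : momentGen q (a * (q : ℂ) ^ (i + 1)) *
        (c • qPochPoly (q : ℂ) s).eval (a * (q : ℂ) ^ (i + 1)) =
        c * ((qPochPoly (q : ℂ) s).eval (a * (q : ℂ) ^ (i + 1)) *
          momentGen q (a * (q : ℂ) ^ (i + 1))) := by
      rw [eval_smul, smul_eq_mul]
      ring
    rw [hr]
    refine h.congr_fun fun k => ?_
    rw [eval_monomial]
    ring

lemma jackson_term {q : ℝ} (hq0 : 0 < q) (α : ℝ) (P : ℂ[X]) (i k : ℕ) :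
    P.eval (((q ^ k : ℝ)) : ℂ) * ((q ^ k : ℝ) : ℂ) ^ i * littleJacobiWeight q α (q ^ k) =
      P.eval ((q : ℂ) ^ k) * ((q : ℂ) ^ k) ^ i *
        ((((q ^ α : ℝ) : ℂ)) ^ k * qPochInf q (q * (q : ℂ) ^ k)) := by
  have h : ((q ^ k : ℝ) ^ α : ℝ) = (q ^ α) ^ k := by
    rw [← Real.rpow_natCast, ← Real.rpow_mul hq0.le, mul_comm, Real.rpow_mul hq0.le,
      Real.rpow_natCast]
  rw [littleJacobiWeight, h]
  push_cast
  rfl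

lemma norm_rpow_mul_lt_one {q α : ℝ} (hq0 : 0 < q) (hq1 : q < 1) (hα : -1 < α) :
    ‖((q ^ α : ℝ) : ℂ) * q‖ < 1 := by
  have h : (q ^ α) * q = q ^ (α + 1) := by rw [Real.rpow_add hq0, Real.rpow_one]
  rw [← Complex.ofReal_mul, h, Complex.norm_real, Real.norm_eq_abs,
    abs_of_pos (Real.rpow_pos_of_pos hq0 _)]
  exact Real.rpow_lt_one hq0.le hq1 (by linarith)

lemma jacksonIntegral_eq {q α : ℝ} (hq0 : 0 < q) (hq1 : q < 1) (hα : -1 < α) (i : ℕ) (P : ℂ[X]) :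
    jacksonIntegral q (fun x => P.eval (x : ℂ) * (x : ℂ) ^ i * littleJacobiWeight q α x) =
      momentGen q (((q ^ α : ℝ) : ℂ) * (q : ℂ) ^ (i + 1)) *
        (qMellin q P).eval (((q ^ α : ℝ) : ℂ) * (q : ℂ) ^ (i + 1)) := by
  rw [← (hasSum_jackson hq0 hq1 (norm_rpow_mul_lt_one hq0 hq1 hα) i P).tsum_eq, jacksonIntegral]
  exact tsum_congr fun k => by rw [jackson_term hq0]

lemma jacksonIntegral_eq_zero_iff {q α : ℝ} (hq0 : 0 < q) (hq1 : q < 1) (hα : -1 < α) (i : ℕ)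
    (P : ℂ[X]) :
    jacksonIntegral q (fun x => P.eval (x : ℂ) * (x : ℂ) ^ i * littleJacobiWeight q α x) = 0 ↔
      (qMellin q P).eval (((q ^ α : ℝ) : ℂ) * (q : ℂ) ^ (i + 1)) = 0 := by
  have hu : ‖((q ^ α : ℝ) : ℂ) * (q : ℂ) ^ (i + 1)‖ < 1 := by
    rw [pow_succ', ← mul_assoc]
    exact norm_mul_pow_lt_one hq0 hq1 (norm_rpow_mul_lt_one hq0 hq1 hα) i
  rw [jacksonIntegral_eq hq0 hq1 hα, mul_eq_zero, or_iff_right (momentGen_ne_zero hq0 hq1 hu)]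

/-! ### Multiple orthogonality as interpolation -/

/-- The polynomial `∏_{i < k} (u - a q^{i+1})`. -/
def nodePoly (q a : ℂ) (k : ℕ) : ℂ[X] := ∏ i ∈ Finset.range k, (X - C (a * q ^ (i + 1)))

lemma monic_nodePoly (q a : ℂ) (k : ℕ) : (nodePoly q a k).Monic :=
  monic_prod_of_monic _ _ fun _ _ => monic_X_sub_C _

lemma natDegree_nodePoly (q a : ℂ) (k : ℕ) : (nodePoly q a k).natDegree = k := by
  rw [nodePoly, natDegree_prod_of_monic _ _ fun _ _ => monic_X_sub_C _]
  simp only [natDegree_X_sub_C, Finset.sum_const, Finset.card_range, smul_eq_mul, mul_one]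

lemma eval_nodePoly {q a : ℂ} {k i : ℕ} (hi : i < k) :
    (nodePoly q a k).eval (a * q ^ (i + 1)) = 0 := by
  rw [nodePoly, eval_prod]
  exact Finset.prod_eq_zero (Finset.mem_range.2 hi) (by simp)

lemma nodePoly_comp (q a : ℂ) (k : ℕ) :
    (X - C (a * q ^ k)) * (nodePoly q a k).comp (C q * X) =
      C (q ^ k) * ((X - C a) * nodePoly q a k) := by
  have h1 : (nodePoly q a k).comp (C q * X) =
      C (q ^ k) * ∏ i ∈ Finset.range k, (X - C (a * q ^ i)) := by
    rw [nodePoly, prod_comp, C_pow, ← Finset.card_range k, ← Finset.prod_const,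
      Finset.card_range, ← Finset.prod_mul_distrib]
    refine Finset.prod_congr rfl fun i _ => ?_
    rw [sub_comp, X_comp, C_comp, mul_sub, ← C_mul]
    ring_nf
  have h2 : (∏ i ∈ Finset.range k, (X - C (a * q ^ i))) * (X - C (a * q ^ k)) =
      nodePoly q a k * (X - C a) := by
    rw [← Finset.prod_range_succ, Finset.prod_range_succ', nodePoly]
    simp
  rw [h1]
  linear_combination C (q ^ k) * h2

lemma eq_zero_of_eval_nodes {q a b : ℂ} (hinj : Function.Injective fun i : ℕ => q ^ i)
    (ha : a ≠ 0) (hb : b ≠ 0) (hne : ∀ i j : ℕ, a * q ^ i ≠ b * q ^ j) {k m : ℕ} {F : ℂ[X]}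
    (hdeg : F.degree < (k + m : ℕ)) (h1 : ∀ i < k, F.eval (a * q ^ (i + 1)) = 0)
    (h2 : ∀ j < m, F.eval (b * q ^ (j + 1)) = 0) : F = 0 := by
  let f : Fin k ⊕ Fin m → ℂ :=
    Sum.elim (fun i => a * q ^ ((i : ℕ) + 1)) (fun j => b * q ^ ((j : ℕ) + 1))
  have hf : Function.Injective f := by
    refine Function.Injective.sumElim (fun i j h => ?_) (fun i j h => ?_)
      (fun i j => hne _ _)
    · have := hinj (mul_left_cancel₀ ha h); exact Fin.ext (by simpa using this)
    · have := hinj (mul_left_cancel₀ hb h); exact Fin.ext (by simpa using this)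
  refine eq_zero_of_degree_lt_of_eval_index_eq_zero Finset.univ (v := f) hf.injOn
    (by simpa using hdeg) ?_
  rintro (i | j) -
  · exact h1 i i.2
  · exact h2 j j.2

/-- The interpolation conditions and the leading coefficient determine the `q`-Mellin transform. -/
lemma eq_C_mul_nodePoly {q a b : ℂ} (hinj : Function.Injective fun i : ℕ => q ^ i)
    (ha : a ≠ 0) (hb : b ≠ 0) (hne : ∀ i j : ℕ, a * q ^ i ≠ b * q ^ j) {k m : ℕ} {F : ℂ[X]}
    (hdeg : F.natDegree ≤ k + m) (h1 : ∀ i < k, F.eval (a * q ^ (i + 1)) = 0)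
    (h2 : ∀ j < m, F.eval (b * q ^ (j + 1)) = 0) :
    F = C (F.coeff (k + m)) * (nodePoly q a k * nodePoly q b m) := by
  have hD : (nodePoly q a k * nodePoly q b m).Monic :=
    (monic_nodePoly q a k).mul (monic_nodePoly q b m)
  have hDdeg : (nodePoly q a k * nodePoly q b m).natDegree = k + m := by
    rw [(monic_nodePoly q a k).natDegree_mul (monic_nodePoly q b m), natDegree_nodePoly,
      natDegree_nodePoly]
  rw [← sub_eq_zero]
  refine eq_zero_of_eval_nodes hinj ha hb hne (k := k) (m := m) ?_ ?_ ?_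
  · refine (degree_lt_iff_coeff_zero _ _).2 fun j hj => ?_
    rw [coeff_sub, coeff_C_mul]
    rcases hj.eq_or_lt with rfl | hj
    · have : (nodePoly q a k * nodePoly q b m).coeff (k + m) = 1 := by
        rw [← hDdeg]; exact hD.coeff_natDegree
      rw [this, mul_one, sub_self]
    · rw [coeff_eq_zero_of_natDegree_lt (hdeg.trans_lt hj),
        coeff_eq_zero_of_natDegree_lt (hDdeg.trans_lt hj), mul_zero, sub_zero]
  · intro i hi
    simp [h1 i hi, eval_nodePoly hi]
  · intro j hj
    simp [h2 j hj, eval_nodePoly hj]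

lemma qMellin_surjective {q : ℂ} (hq : q ≠ 0) : Function.Surjective (qMellin q) := by
  intro F
  let N := F.natDegree + 1
  have hmaps : ∀ P ∈ degreeLT ℂ N, qMellin q P ∈ degreeLT ℂ N := fun P hP => by
    rw [mem_degreeLT] at hP ⊢
    rwa [degree_qMellin hq]
  have : FiniteDimensional ℂ (degreeLT ℂ N) := (degreeLTEquiv ℂ N).symm.finiteDimensional
  have hi : Function.Injective ((qMellin q).restrict hmaps) := fun P Q h =>
    Subtype.ext (qMellin_injective hq (congrArg Subtype.val h))
  obtain ⟨P, hP⟩ := LinearMap.injective_iff_surjective.1 hi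
    ⟨F, by rw [mem_degreeLT]; exact degree_le_natDegree.trans_lt (by norm_cast; simp [N])⟩
  exact ⟨P, congrArg Subtype.val hP⟩

/-- The third-order relation satisfied by the inverse `q`-Mellin transform of a multiple of
`∏ (u - a q^{i+1}) ∏ (u - b q^{j+1})`. It expresses
`(U - a q^k) (U - b q^m) x P = q^{k+m} (U - a) (U - b) (1 - U) P`, where `U` is the backward
operator. -/
lemma backwardOp_relation {q a b : ℂ} (hq : q ≠ 0) {k m : ℕ} {P : ℂ[X]} {c : ℂ}
    (hP : qMellin q P = C c * (nodePoly q a k * nodePoly q b m)) :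
    backwardOp q (backwardOp q (X * P)) - C (a * q ^ k + b * q ^ m) * backwardOp q (X * P)
        + C (a * q ^ k * (b * q ^ m)) * (X * P) =
      C (q ^ (k + m)) * (-backwardOp q (backwardOp q (backwardOp q P))
        + C (1 + a + b) * backwardOp q (backwardOp q P)
        - C (a + b + a * b) * backwardOp q P + C (a * b) * P) := by
  apply qMellin_injective hq
  simp only [← smul_eq_C_mul]
  simp only [map_add, map_sub, map_neg, map_smul, qMellin_backwardOp hq,
    qMellin_X_mul, hP]
  simp only [smul_eq_C_mul, mul_comp, C_comp, C_add, C_mul, C_1]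
  have h1 := nodePoly_comp q a k
  have h2 := nodePoly_comp q b m
  rw [C_mul] at h1 h2
  rw [pow_add, C_mul]
  linear_combination C c * (1 - X) * ((X - C b * C (q ^ m)) *
    (nodePoly q b m).comp (C q * X)) * h1 +
    C c * (1 - X) * (C (q ^ k) * ((X - C a) * nodePoly q a k)) * h2

lemma eval_backwardOp (q z : ℂ) (P : ℂ[X]) :
    (backwardOp q P).eval z = (1 - z) * P.eval (z / q) := by
  simp [backwardOp, div_eq_inv_mul]

/-- The `q`-difference equation: multiplication by `(q z; q)_∞` turns the backward operator
into the shift `z ↦ z / q`. -/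
lemma qDifference_of_qMellin {q : ℝ} (hq0 : 0 < q) (hq1 : q < 1) {a b : ℂ} {k m : ℕ} {P : ℂ[X]}
    {c : ℂ} (hP : qMellin q P = C c * (nodePoly q a k * nodePoly q b m)) (x : ℂ) :
    (q : ℂ) ^ (k + m) * (P.eval x * qPochInf q (q * x)) =
      ((q : ℂ) ^ (k + m) * (1 + a + b) - q * x) * (P.eval (q * x) * qPochInf q (q * (q * x)))
      + (-((q : ℂ) ^ (k + m) * (a + b + a * b)) + (a * (q : ℂ) ^ k + b * (q : ℂ) ^ m) * (q ^ 2 * x))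
        * (P.eval (q ^ 2 * x) * qPochInf q (q * (q ^ 2 * x)))
      + (q : ℂ) ^ (k + m) * (a * b) * (1 - q ^ 3 * x)
        * (P.eval (q ^ 3 * x) * qPochInf q (q * (q ^ 3 * x))) := by
  have hq : (q : ℂ) ≠ 0 := by exact_mod_cast hq0.ne'
  have h := congrArg (eval ((q : ℂ) ^ 3 * x)) (backwardOp_relation hq hP)
  have e1 : (q : ℂ) ^ 3 * x / q = q ^ 2 * x := by field_simp
  have e2 : (q : ℂ) ^ 2 * x / q = q * x := by field_simp
  have e3 : (q : ℂ) * x / q = x := by field_simp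
  simp only [eval_add, eval_sub, eval_mul, eval_C, eval_backwardOp, eval_X, eval_neg, e1, e2,
    e3] at h
  have w1 := qPochInf_eq_one_sub_mul hq0 hq1 (q * x)
  have w2 := qPochInf_eq_one_sub_mul hq0 hq1 (q * (q * x))
  have w3 := qPochInf_eq_one_sub_mul hq0 hq1 (q * (q ^ 2 * x))
  have f1 : (q : ℂ) * (q * (q * x)) = q * (q ^ 2 * x) := by ring
  have f2 : (q : ℂ) * (q * (q ^ 2 * x)) = q * (q ^ 3 * x) := by ring
  rw [f1] at w2
  rw [f2] at w3
  rw [w1, w2, w3]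
  linear_combination (qPochInf q (q * (q ^ 3 * x))) * h

section MultipleOrthogonal

variable {q α β : ℝ}

lemma pow_injective_of_lt_one (hq0 : 0 < q) (hq1 : q < 1) :
    Function.Injective fun i : ℕ => (q : ℂ) ^ i := fun i j h =>
  pow_right_injective₀ hq0 hq1.ne (by
    have h' : (q : ℂ) ^ i = (q : ℂ) ^ j := h
    exact_mod_cast h')

lemma ofReal_rpow_ne_zero (hq0 : 0 < q) (α : ℝ) : ((q ^ α : ℝ) : ℂ) ≠ 0 := by
  exact_mod_cast (Real.rpow_pos_of_pos hq0 α).ne'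

/-- Non-integrality of `α - β` keeps the two families of interpolation nodes apart. -/
lemma rpow_mul_pow_ne (hq0 : 0 < q) (hq1 : q < 1) (hαβ : ∀ k : ℤ, α - β ≠ k) (i j : ℕ) :
    ((q ^ α : ℝ) : ℂ) * (q : ℂ) ^ i ≠ ((q ^ β : ℝ) : ℂ) * (q : ℂ) ^ j := by
  intro h
  have h1 : q ^ α * q ^ i = q ^ β * q ^ j := by exact_mod_cast h
  rw [← Real.rpow_natCast, ← Real.rpow_natCast, ← Real.rpow_add hq0, ← Real.rpow_add hq0] at h1
  have h2 : α + i = β + j := by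
    have := congrArg Real.log h1
    rw [Real.log_rpow hq0, Real.log_rpow hq0] at this
    exact mul_right_cancel₀ (Real.log_neg hq0 hq1).ne this
  refine hαβ (j - i) ?_
  push_cast
  linarith

lemma IsMultipleOrthogonal.symm {w₁ w₂ : ℝ → ℂ} {k m : ℕ} {P : ℂ[X]}
    (h : IsMultipleOrthogonal q w₁ w₂ k m P) : IsMultipleOrthogonal q w₂ w₁ m k P where
  monic := h.monic
  natDegree_eq := by rw [h.natDegree_eq, add_comm]
  orthogonal_left := h.orthogonal_right
  orthogonal_right := h.orthogonal_left

lemma qMellin_eq_of_orthogonal (hq0 : 0 < q) (hq1 : q < 1) (hα : -1 < α) (hβ : -1 < β)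
    (hαβ : ∀ k : ℤ, α - β ≠ k) {k m : ℕ} {Q : ℂ[X]} (hdeg : Q.natDegree ≤ k + m)
    (h1 : ∀ i < k, jacksonIntegral q
      (fun x => Q.eval (x : ℂ) * (x : ℂ) ^ i * littleJacobiWeight q α x) = 0)
    (h2 : ∀ j < m, jacksonIntegral q
      (fun x => Q.eval (x : ℂ) * (x : ℂ) ^ j * littleJacobiWeight q β x) = 0) :
    qMellin q Q = C ((qMellin q Q).coeff (k + m)) *
      (nodePoly q ((q ^ α : ℝ) : ℂ) k * nodePoly q ((q ^ β : ℝ) : ℂ) m) := by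
  have hq : (q : ℂ) ≠ 0 := by exact_mod_cast hq0.ne'
  refine eq_C_mul_nodePoly (pow_injective_of_lt_one hq0 hq1) (ofReal_rpow_ne_zero hq0 α)
    (ofReal_rpow_ne_zero hq0 β) (rpow_mul_pow_ne hq0 hq1 hαβ) ?_
    (fun i hi => (jacksonIntegral_eq_zero_iff hq0 hq1 hα i Q).1 (h1 i hi))
    (fun j hj => (jacksonIntegral_eq_zero_iff hq0 hq1 hβ j Q).1 (h2 j hj))
  rwa [natDegree_eq_of_degree_eq (degree_qMellin hq Q)]

lemma eq_C_mul_of_orthogonal (hq0 : 0 < q) (hq1 : q < 1) (hα : -1 < α) (hβ : -1 < β)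
    (hαβ : ∀ k : ℤ, α - β ≠ k) {k m : ℕ} {P Q : ℂ[X]}
    (hP : IsMultipleOrthogonal q (littleJacobiWeight q α) (littleJacobiWeight q β) k m P)
    (hdeg : Q.natDegree ≤ k + m)
    (h1 : ∀ i < k, jacksonIntegral q
      (fun x => Q.eval (x : ℂ) * (x : ℂ) ^ i * littleJacobiWeight q α x) = 0)
    (h2 : ∀ j < m, jacksonIntegral q
      (fun x => Q.eval (x : ℂ) * (x : ℂ) ^ j * littleJacobiWeight q β x) = 0) :
    Q = C (Q.coeff (k + m)) * P := by
  have hq : (q : ℂ) ≠ 0 := by exact_mod_cast hq0.ne'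
  have hTP := qMellin_eq_of_orthogonal hq0 hq1 hα hβ hαβ hP.natDegree_eq.le hP.orthogonal_left
    hP.orthogonal_right
  have hTQ := qMellin_eq_of_orthogonal hq0 hq1 hα hβ hαβ hdeg h1 h2
  set x := (qMellin q P).coeff (k + m)
  set y := (qMellin q Q).coeff (k + m)
  have hx : x ≠ 0 := by
    intro h0
    rw [h0, C_0, zero_mul] at hTP
    refine hP.monic.ne_zero (qMellin_injective hq ?_)
    rw [hTP, map_zero]
  have hQ : Q = C (y / x) * P := by
    apply qMellin_injective hq
    rw [← smul_eq_C_mul, map_smul, hTP, hTQ, smul_eq_C_mul, ← mul_assoc (C (y / x)), ← C_mul,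
      div_mul_cancel₀ _ hx]
  have hc : Q.coeff (k + m) = y / x := by
    rw [hQ, coeff_C_mul, ← hP.natDegree_eq, hP.monic.coeff_natDegree, mul_one]
  rw [hc]
  exact hQ

lemma existsUnique_isMultipleOrthogonal (hq0 : 0 < q) (hq1 : q < 1) (hα : -1 < α) (hβ : -1 < β)
    (hαβ : ∀ k : ℤ, α - β ≠ k) (k m : ℕ) :
    ∃! P : ℂ[X],
      IsMultipleOrthogonal q (littleJacobiWeight q α) (littleJacobiWeight q β) k m P := by
  have hq : (q : ℂ) ≠ 0 := by exact_mod_cast hq0.ne'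
  set D := nodePoly q ((q ^ α : ℝ) : ℂ) k * nodePoly q ((q ^ β : ℝ) : ℂ) m with hD
  have hDm : D.Monic := (monic_nodePoly _ _ _).mul (monic_nodePoly _ _ _)
  have hDdeg : D.natDegree = k + m := by
    rw [hD, (monic_nodePoly _ _ _).natDegree_mul (monic_nodePoly _ _ _), natDegree_nodePoly,
      natDegree_nodePoly]
  obtain ⟨P, hP⟩ := qMellin_surjective hq D
  have hP0 : P ≠ 0 := by
    rintro rfl
    exact hDm.ne_zero (by rw [← hP, map_zero])
  have hl : P.leadingCoeff⁻¹ ≠ 0 := inv_ne_zero (leadingCoeff_ne_zero.2 hP0)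
  have hT : qMellin q (C P.leadingCoeff⁻¹ * P) = C P.leadingCoeff⁻¹ * D := by
    rw [← smul_eq_C_mul, map_smul, hP, smul_eq_C_mul]
  have hex : IsMultipleOrthogonal q (littleJacobiWeight q α) (littleJacobiWeight q β) k m
      (C P.leadingCoeff⁻¹ * P) := by
    refine ⟨?_, ?_, fun i hi => ?_, fun j hj => ?_⟩
    · rw [mul_comm]; exact monic_mul_leadingCoeff_inv hP0
    · rw [natDegree_C_mul hl, ← hDdeg, ← hP]
      exact (natDegree_eq_of_degree_eq (degree_qMellin hq P)).symm
    · rw [jacksonIntegral_eq_zero_iff hq0 hq1 hα, hT, hD]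
      simp only [eval_mul, eval_nodePoly hi, zero_mul, mul_zero]
    · rw [jacksonIntegral_eq_zero_iff hq0 hq1 hβ, hT, hD]
      simp only [eval_mul, eval_nodePoly hj, mul_zero]
  refine ⟨_, hex, fun Q hQ => ?_⟩
  have := eq_C_mul_of_orthogonal hq0 hq1 hα hβ hαβ hex hQ.natDegree_eq.le hQ.orthogonal_left
    hQ.orthogonal_right
  rwa [← hQ.natDegree_eq, hQ.monic.coeff_natDegree, C_1, one_mul] at this

/-- One more vanishing integral would give the transform of `P` more zeros than its degree. -/
lemma jacksonIntegral_ne_zero (hq0 : 0 < q) (hq1 : q < 1) (hα : -1 < α) (hβ : -1 < β)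
    (hαβ : ∀ k : ℤ, α - β ≠ k) {k m : ℕ} {P : ℂ[X]}
    (hP : IsMultipleOrthogonal q (littleJacobiWeight q α) (littleJacobiWeight q β) k m P) :
    jacksonIntegral q (fun x => P.eval (x : ℂ) * (x : ℂ) ^ k * littleJacobiWeight q α x) ≠ 0 := by
  intro h0
  obtain ⟨R, hR, -⟩ := existsUnique_isMultipleOrthogonal hq0 hq1 hα hβ hαβ (k + 1) m
  have := eq_C_mul_of_orthogonal hq0 hq1 hα hβ hαβ hR (Q := P)
    (by rw [hP.natDegree_eq]; omega)
    (fun i hi => by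
      rcases (Nat.lt_succ_iff.1 hi).eq_or_lt with rfl | hi
      · exact h0
      · exact hP.orthogonal_left i hi) hP.orthogonal_right
  rw [coeff_eq_zero_of_natDegree_lt (by rw [hP.natDegree_eq]; omega), C_0, zero_mul] at this
  exact hP.monic.ne_zero this

/-- The equation of `qDifference_of_qMellin` at `x = t q^{2n}`. The factor `q^{k+m}` is kept on
both sides so that no negative powers of `q` occur. -/
lemma IsMultipleOrthogonal.rescaledEntry_qDifference (hq0 : 0 < q) (hq1 : q < 1) (hα : -1 < α)
    (hβ : -1 < β) (hαβ : ∀ k : ℤ, α - β ≠ k) {k m n : ℕ} {P : ℂ[X]}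
    (hP : IsMultipleOrthogonal q (littleJacobiWeight q α) (littleJacobiWeight q β) k m P)
    {a b : ℂ} (ha : a = ((q ^ α : ℝ) : ℂ)) (hb : b = ((q ^ β : ℝ) : ℂ)) {f : ℂ → ℂ} {d : ℂ}
    (hf : ∀ z, f z = d * P.eval z) (t : ℂ) :
    (q : ℂ) ^ (k + m) * rescaledEntry q n f t =
      ((q : ℂ) ^ (k + m) * (1 + a + b) - (q : ℂ) ^ (2 * n + 1) * t) * rescaledEntry q n f (q * t)
      + (-((q : ℂ) ^ (k + m) * (a + b + a * b)) +
          (a * (q : ℂ) ^ k + b * (q : ℂ) ^ m) * (q : ℂ) ^ (2 * n + 2) * t) *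
          rescaledEntry q n f ((q : ℂ) ^ 2 * t)
      + (q : ℂ) ^ (k + m) * (a * b - (q : ℂ) ^ (3 + 2 * n) * a * b * t) *
          rescaledEntry q n f ((q : ℂ) ^ 3 * t) := by
  have hTP := qMellin_eq_of_orthogonal hq0 hq1 hα hβ hαβ hP.natDegree_eq.le hP.orthogonal_left
    hP.orthogonal_right
  rw [← ha, ← hb] at hTP
  have h := qDifference_of_qMellin hq0 hq1 hTP (t * (q : ℂ) ^ (2 * n))
  have key : ∀ s : ℂ, rescaledEntry q n f (s * t) =
      d * (P.eval (s * (t * (q : ℂ) ^ (2 * n))) *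
        qPochInf q (q * (s * (t * (q : ℂ) ^ (2 * n))))) := fun s => by
    rw [rescaledEntry, hf, mul_assoc d]
    ring_nf
  have key1 := key 1
  simp only [one_mul] at key1
  rw [key, key, key, key1]
  linear_combination d * h

end MultipleOrthogonal

end Polynomials

/-! ### Rectifiable curves are removable for continuous functions -/

section Removable

open Complex Set

/-- A rectifiable Jordan curve is covered by a Lipschitz map on the unit interval. -/
lemma IsRectifiableJordanCurve.exists_lipschitz {Γ : Set ℂ} (hΓ : IsRectifiableJordanCurve Γ) :
    ∃ (g : ℝ → ℂ) (K : ℝ), 0 < K ∧ (∀ s t, dist (g s) (g t) ≤ K * |s - t|) ∧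
      Γ ⊆ g '' Icc 0 1 := by
  obtain ⟨γ, ⟨K, hK⟩, -, rfl⟩ := hΓ
  refine ⟨fun t => γ (Circle.exp (2 * Real.pi * t - Real.pi)), (K + 1) * (2 * Real.pi),
    by positivity, fun s t => ?_, ?_⟩
  · have h1 : ∀ x y : ℝ, dist (Circle.exp x) (Circle.exp y) ≤ |x - y| := fun x y => by
      have h2 : ((Circle.exp x : Circle) : ℂ) - (Circle.exp y : Circle) =
          (Circle.exp y : Circle) * (Complex.exp (Complex.I * ((x - y : ℝ) : ℂ)) - 1) := by
        rw [Circle.coe_exp, Circle.coe_exp, mul_sub, ← Complex.exp_add, mul_one]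
        push_cast
        ring_nf
      change dist ((Circle.exp x : Circle) : ℂ) (Circle.exp y : Circle) ≤ _
      rw [dist_eq_norm, h2, norm_mul, Circle.norm_coe, one_mul]
      exact Real.norm_exp_I_mul_ofReal_sub_one_le
    refine (hK.dist_le_mul _ _).trans ?_
    have h3 := h1 (2 * Real.pi * s - Real.pi) (2 * Real.pi * t - Real.pi)
    have h4 : |2 * Real.pi * s - Real.pi - (2 * Real.pi * t - Real.pi)| =
        2 * Real.pi * |s - t| := by
      rw [← abs_of_pos Real.two_pi_pos, ← abs_mul, abs_of_pos Real.two_pi_pos]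
      ring_nf
    rw [h4] at h3
    calc (K : ℝ) * _ ≤ (K + 1) * (2 * Real.pi * |s - t|) := by
          gcongr
          linarith
      _ = _ := by ring
  · rintro _ ⟨z, rfl⟩
    have hpi := Real.pi_pos
    refine ⟨((z : ℂ).arg + Real.pi) / (2 * Real.pi), ⟨?_, ?_⟩, ?_⟩
    · have := Complex.neg_pi_lt_arg (z : ℂ)
      exact div_nonneg (by linarith) (by positivity)
    · rw [div_le_one (by positivity)]
      have := Complex.arg_le_pi (z : ℂ)
      linarith
    · have : 2 * Real.pi * (((z : ℂ).arg + Real.pi) / (2 * Real.pi)) - Real.pi = (z : ℂ).arg := by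
        field_simp
        ring
      simp only [this, Circle.exp_arg]

/-- The integral of `f` over the boundary of `[x₀, x₁] × [y₀, y₁]`, counterclockwise when
`x₀ ≤ x₁` and `y₀ ≤ y₁`. -/
def rectIntegral (f : ℂ → ℂ) (x₀ x₁ y₀ y₁ : ℝ) : ℂ :=
  (∫ x : ℝ in x₀..x₁, f (x + y₀ * I)) - (∫ x : ℝ in x₀..x₁, f (x + y₁ * I)) +
    I • (∫ y : ℝ in y₀..y₁, f (x₁ + y * I)) - I • (∫ y : ℝ in y₀..y₁, f (x₀ + y * I))

lemma rectIntegral_swap_re (f : ℂ → ℂ) (x₀ x₁ y₀ y₁ : ℝ) :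
    rectIntegral f x₁ x₀ y₀ y₁ = -rectIntegral f x₀ x₁ y₀ y₁ := by
  rw [rectIntegral, rectIntegral, intervalIntegral.integral_symm x₀ x₁,
    intervalIntegral.integral_symm x₀ x₁]
  ring

lemma rectIntegral_swap_im (f : ℂ → ℂ) (x₀ x₁ y₀ y₁ : ℝ) :
    rectIntegral f x₀ x₁ y₁ y₀ = -rectIntegral f x₀ x₁ y₀ y₁ := by
  rw [rectIntegral, rectIntegral, intervalIntegral.integral_symm y₀ y₁,
    intervalIntegral.integral_symm y₀ y₁, smul_neg, smul_neg]
  ring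

lemma sum_rectIntegral {F : ℂ → ℂ} (hF : Continuous F) (x y : ℕ → ℝ) (M N : ℕ) :
    ∑ i ∈ Finset.range M, ∑ j ∈ Finset.range N,
      rectIntegral F (x i) (x (i + 1)) (y j) (y (j + 1)) =
      rectIntegral F (x 0) (x M) (y 0) (y N) := by
  have hh : ∀ (c : ℝ) (u v : ℝ), IntervalIntegrable (fun s : ℝ => F (s + c * I))
      MeasureTheory.volume u v := fun c u v =>
    Continuous.intervalIntegrable (by fun_prop) _ _
  have hv : ∀ (c : ℝ) (u v : ℝ), IntervalIntegrable (fun s : ℝ => F (c + s * I))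
      MeasureTheory.volume u v := fun c u v =>
    Continuous.intervalIntegrable (by fun_prop) _ _
  have h1 : ∀ i, ∑ j ∈ Finset.range N, rectIntegral F (x i) (x (i + 1)) (y j) (y (j + 1)) =
      rectIntegral F (x i) (x (i + 1)) (y 0) (y N) := fun i => by
    have hL := fun c : ℝ => intervalIntegral.sum_integral_adjacent_intervals (n := N)
      (fun k _ => hv c (y k) (y (k + 1)))
    have hT := Finset.sum_range_sub'
      (fun j => ∫ s : ℝ in (x i)..(x (i + 1)), F (s + (y j : ℝ) * I)) N
    simp only [rectIntegral]
    rw [Finset.sum_sub_distrib, Finset.sum_add_distrib, hT, ← Finset.smul_sum, ← Finset.smul_sum,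
      hL, hL]
  have hL := fun c : ℝ => intervalIntegral.sum_integral_adjacent_intervals (n := M)
    (fun k _ => hh c (x k) (x (k + 1)))
  have hT := Finset.sum_range_sub
    (fun i => ∫ s : ℝ in (y 0)..(y N), F ((x i : ℝ) + s * I)) M
  simp only [h1]
  simp only [rectIntegral, add_sub_assoc, ← smul_sub]
  rw [Finset.sum_add_distrib, Finset.sum_sub_distrib, hL, hL, ← Finset.smul_sum, hT]

lemma norm_rectIntegral_le {F : ℂ → ℂ} (hF : Continuous F) {x₀ x₁ y₀ y₁ ε : ℝ} (hx : x₀ ≤ x₁)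
    (hy : y₀ ≤ y₁)
    (h1 : ∀ x ∈ Icc x₀ x₁, ‖F (x + y₀ * I) - F (x + y₁ * I)‖ ≤ ε)
    (h2 : ∀ y ∈ Icc y₀ y₁, ‖F (x₁ + y * I) - F (x₀ + y * I)‖ ≤ ε) :
    ‖rectIntegral F x₀ x₁ y₀ y₁‖ ≤ ε * ((x₁ - x₀) + (y₁ - y₀)) := by
  have e : rectIntegral F x₀ x₁ y₀ y₁ =
      (∫ x : ℝ in x₀..x₁, (F (x + y₀ * I) - F (x + y₁ * I))) +
      I • ∫ y : ℝ in y₀..y₁, (F (x₁ + y * I) - F (x₀ + y * I)) := by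
    rw [intervalIntegral.integral_sub, intervalIntegral.integral_sub, rectIntegral, smul_sub,
      add_sub_assoc]
    all_goals exact Continuous.intervalIntegrable (by fun_prop) _ _
  have b1 := intervalIntegral.norm_integral_le_of_norm_le_const (a := x₀) (b := x₁) (C := ε)
    (f := fun x : ℝ => F (x + y₀ * I) - F (x + y₁ * I)) fun x hx' => by
      rw [uIoc_of_le hx] at hx'
      exact h1 x (Ioc_subset_Icc_self hx')
  have b2 := intervalIntegral.norm_integral_le_of_norm_le_const (a := y₀) (b := y₁) (C := ε)
    (f := fun y : ℝ => F (x₁ + y * I) - F (x₀ + y * I)) fun y hy' => by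
      rw [uIoc_of_le hy] at hy'
      exact h2 y (Ioc_subset_Icc_self hy')
  rw [abs_of_nonneg (sub_nonneg.2 hx)] at b1
  rw [abs_of_nonneg (sub_nonneg.2 hy)] at b2
  rw [e]
  refine (norm_add_le _ _).trans ?_
  rw [norm_smul, norm_I, one_mul, mul_add]
  exact add_le_add b1 b2

/-- A `1`-dimensional set meets only `O(N)` cells of an `N × N` grid: cut the parameter interval
into `m N` pieces whose images are smaller than a cell; each image meets at most `16` cells. -/
lemma card_cells_le {g : ℝ → ℂ} {K : ℝ} (hg : ∀ s t, dist (g s) (g t) ≤ K * |s - t|)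
    {x₀ y₀ w v : ℝ} (hw : 0 < w) (hv : 0 < v) {m : ℕ} (hm : 0 < m) (hmw : K ≤ m * w)
    (hmv : K ≤ m * v) {N : ℕ} (hN : 0 < N) (S : Finset (ℕ × ℕ))
    (hS : ∀ p ∈ S, ∃ t ∈ Icc (0 : ℝ) 1,
      (g t).re ∈ Icc (x₀ + p.1 * (w / N)) (x₀ + (p.1 + 1) * (w / N)) ∧
      (g t).im ∈ Icc (y₀ + p.2 * (v / N)) (y₀ + (p.2 + 1) * (v / N))) :
    S.card ≤ (m * N + 1) * 16 := by
  classical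
  have hN' : (0 : ℝ) < N := by exact_mod_cast hN
  have hm' : (0 : ℝ) < m := by exact_mod_cast hm
  let e : ℕ → ℤ := fun p => ⌊((g (p / (m * N))).re - x₀) / (w / N)⌋
  let f : ℕ → ℤ := fun p => ⌊((g (p / (m * N))).im - y₀) / (v / N)⌋
  let T : Finset (ℤ × ℤ) := (Finset.range (m * N + 1)).biUnion fun p =>
    Finset.Icc (e p - 2) (e p + 1) ×ˢ Finset.Icc (f p - 2) (f p + 1)
  have hT : T.card ≤ (m * N + 1) * 16 := by
    refine (Finset.card_biUnion_le_card_mul _ _ 16 fun p _ => ?_).trans (by simp)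
    rw [Finset.card_product, Int.card_Icc, Int.card_Icc]
    have h1 : (e p + 1 + 1 - (e p - 2)).toNat = 4 := by omega
    have h2 : (f p + 1 + 1 - (f p - 2)).toNat = 4 := by omega
    rw [h1, h2]
  refine (Finset.card_le_card_of_injOn (fun p : ℕ × ℕ => ((p.1 : ℤ), (p.2 : ℤ))) ?_ ?_).trans hT
  · -- the index of a cell is determined up to `4` choices by that of a nearby point
    have aux : ∀ (c d u r : ℝ) (i : ℕ), 0 < u → |d - c| ≤ u → d ∈ Icc (r + i * u) (r + (i + 1) * u) →
        ⌊(c - r) / u⌋ - 2 ≤ (i : ℤ) ∧ (i : ℤ) ≤ ⌊(c - r) / u⌋ + 1 := by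
      intro c d u r i hu hdc hd
      obtain ⟨h1, h2⟩ := abs_le.1 hdc
      constructor
      · have : ⌊(c - r) / u⌋ ≤ (i : ℤ) + 2 := by
          rw [← Int.cast_le (R := ℝ)]
          refine (Int.floor_le _).trans ?_
          rw [div_le_iff₀ hu]
          push_cast
          nlinarith [hd.2]
        omega
      · have : (i : ℤ) - 1 ≤ ⌊(c - r) / u⌋ := by
          rw [Int.le_floor, le_div_iff₀ hu]
          push_cast
          nlinarith [hd.1]
        omega
    intro p hp
    obtain ⟨t, ht, hre, him⟩ := hS p hp
    let k := ⌊t * (m * N)⌋₊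
    have hk1 : (k : ℝ) ≤ t * (m * N) := Nat.floor_le (by have := ht.1; positivity)
    have hk2 : t * (m * N) < k + 1 := Nat.lt_floor_add_one _
    have hkr : k < m * N + 1 := by
      rw [Nat.lt_succ_iff]
      have : (k : ℝ) ≤ (m * N : ℕ) := by
        push_cast
        refine hk1.trans ?_
        have : (0 : ℝ) < m * N := by positivity
        nlinarith [ht.2]
      exact_mod_cast this
    have hd : |t - k / (m * N)| ≤ 1 / (m * N) := by
      have h0 : (0 : ℝ) < m * N := by positivity
      have : t - k / (m * N) = (t * (m * N) - k) / (m * N) := by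
        field_simp
      rw [this, abs_div, abs_of_pos h0]
      gcongr
      rw [abs_le]
      constructor <;> linarith
    have hdist : dist (g t) (g (k / (m * N))) ≤ K * (1 / (m * N)) := by
      have hK : 0 ≤ K := by simpa using dist_nonneg.trans (hg 0 1)
      exact (hg _ _).trans (by gcongr)
    have hKw : K * (1 / (m * N)) ≤ w / N := by
      rw [mul_one_div, div_le_div_iff₀ (by positivity) hN']
      nlinarith
    have hKv : K * (1 / (m * N)) ≤ v / N := by
      rw [mul_one_div, div_le_div_iff₀ (by positivity) hN']
      nlinarith
    rw [dist_eq] at hdist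
    have hr := aux (g (k / (m * N))).re (g t).re (w / N) x₀ p.1 (by positivity)
      (((abs_re_le_norm (g t - g (k / (m * N)))).trans hdist).trans hKw) hre
    have hi := aux (g (k / (m * N))).im (g t).im (v / N) y₀ p.2 (by positivity)
      (((abs_im_le_norm (g t - g (k / (m * N)))).trans hdist).trans hKv) him
    simp only [T, Finset.coe_biUnion, mem_iUnion, Finset.mem_coe, Finset.mem_product,
      Finset.mem_Icc]
    exact ⟨k, Finset.mem_range.2 hkr, hr, hi⟩
  · intro p _ p' _ h
    simp only [Prod.mk.injEq, Nat.cast_inj] at h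
    exact Prod.ext h.1 h.2

/-- Only `O(N)` cells of an `N × N` subdivision meet `Γ`, each has perimeter `O(1/N)`, and on each
the oscillation of `F` is small; all other cells contribute zero by Cauchy's theorem. -/
lemma rectIntegral_eq_zero {Γ : Set ℂ} (hΓ : IsRectifiableJordanCurve Γ) {F : ℂ → ℂ}
    (hF : Continuous F) {x₀ x₁ y₀ y₁ : ℝ} (hx : x₀ < x₁) (hy : y₀ < y₁)
    (hd : ∀ z ∈ Ioo x₀ x₁ ×ℂ Ioo y₀ y₁, z ∉ Γ → DifferentiableAt ℂ F z) :
    rectIntegral F x₀ x₁ y₀ y₁ = 0 := by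
  classical
  obtain ⟨g, K, hK, hg, hcov⟩ := hΓ.exists_lipschitz
  set w := x₁ - x₀ with hw'
  set v := y₁ - y₀ with hv'
  have hw : 0 < w := sub_pos.2 hx
  have hv : 0 < v := sub_pos.2 hy
  obtain ⟨m, hm⟩ := exists_nat_gt (max 1 (max (K / w) (K / v)))
  have hm1 : (1 : ℝ) < m := (le_max_left _ _).trans_lt hm
  have hm0 : 0 < m := by
    have : (0 : ℝ) < m := by linarith
    exact_mod_cast this
  have hmw : K ≤ m * w := by
    rw [← div_le_iff₀ hw]
    exact (((le_max_left _ _).trans (le_max_right _ _)).trans_lt hm).le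
  have hmv : K ≤ m * v := by
    rw [← div_le_iff₀ hv]
    exact (((le_max_right _ _).trans (le_max_right _ _)).trans_lt hm).le
  have hcomp : IsCompact (Icc x₀ x₁ ×ℂ Icc y₀ y₁) := isCompact_Icc.reProdIm isCompact_Icc
  have huc := hcomp.uniformContinuousOn_of_continuous hF.continuousOn
  rw [Metric.uniformContinuousOn_iff] at huc
  have main : ∀ ε > 0, ‖rectIntegral F x₀ x₁ y₀ y₁‖ ≤ ε * (16 * (m + 1) * (w + v)) := by
    intro ε hε
    obtain ⟨δ, hδ, hFδ⟩ := huc ε hε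
    obtain ⟨N, hN⟩ := exists_nat_gt (max 1 ((w + v) / δ))
    have hN1 : (1 : ℝ) < N := (le_max_left _ _).trans_lt hN
    have hN' : (0 : ℝ) < N := by linarith
    have hN0 : 0 < N := by exact_mod_cast hN'
    have hNδ : (w + v) / N < δ := by
      rw [div_lt_iff₀ hN', mul_comm, ← div_lt_iff₀ hδ]
      exact (le_max_right _ _).trans_lt hN
    set h := w / N with hh
    set k := v / N with hk
    have hh0 : 0 < h := by positivity
    have hk0 : 0 < k := by positivity
    have hhk : h + k < δ := by rw [hh, hk, ← add_div]; exact hNδ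
    have hNh : N * h = w := by rw [hh]; field_simp
    have hNk : N * k = v := by rw [hk]; field_simp
    let X : ℕ → ℝ := fun i => x₀ + i * h
    let Y : ℕ → ℝ := fun j => y₀ + j * k
    have hXs : ∀ i, X (i + 1) = X i + h := fun i => by simp only [X]; push_cast; ring
    have hYs : ∀ j, Y (j + 1) = Y j + k := fun j => by simp only [Y]; push_cast; ring
    have hX : ∀ i < N, x₀ ≤ X i ∧ X (i + 1) ≤ x₁ := fun i hi => by
      have : ((i + 1 : ℕ) : ℝ) ≤ N := by exact_mod_cast hi
      constructor
      · simp only [X]; nlinarith [(Nat.cast_nonneg i : (0 : ℝ) ≤ i)]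
      · simp only [X]; nlinarith
    have hY : ∀ j < N, y₀ ≤ Y j ∧ Y (j + 1) ≤ y₁ := fun j hj => by
      have : ((j + 1 : ℕ) : ℝ) ≤ N := by exact_mod_cast hj
      constructor
      · simp only [Y]; nlinarith [(Nat.cast_nonneg j : (0 : ℝ) ≤ j)]
      · simp only [Y]; nlinarith
    have hsum := sum_rectIntegral hF X Y N N
    have e1 : X 0 = x₀ := by simp [X]
    have e2 : X N = x₁ := by simp only [X]; linarith
    have e3 : Y 0 = y₀ := by simp [Y]
    have e4 : Y N = y₁ := by simp only [Y]; linarith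
    rw [e1, e2, e3, e4, ← Finset.sum_product'] at hsum
    let G : ℕ × ℕ → ℂ := fun p => rectIntegral F (X p.1) (X (p.1 + 1)) (Y p.2) (Y (p.2 + 1))
    let S : Finset (ℕ × ℕ) := (Finset.range N ×ˢ Finset.range N).filter fun p =>
      ∃ z ∈ Γ, z.re ∈ Icc (X p.1) (X (p.1 + 1)) ∧ z.im ∈ Icc (Y p.2) (Y (p.2 + 1))
    have hgood : ∀ p ∈ Finset.range N ×ˢ Finset.range N, p ∉ S → G p = 0 := by
      rintro ⟨i, j⟩ hp hpS
      have hp' := Finset.mem_product.1 hp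
      have hi := hX i (Finset.mem_range.1 hp'.1)
      have hj := hY j (Finset.mem_range.1 hp'.2)
      have hno : ∀ z ∈ Γ, z.re ∈ Icc (X i) (X (i + 1)) → z.im ∈ Icc (Y j) (Y (j + 1)) → False :=
        fun z hz h1 h2 => hpS (Finset.mem_filter.2 ⟨hp, z, hz, h1, h2⟩)
      have hXle : X i ≤ X (i + 1) := by rw [hXs]; linarith
      have hYle : Y j ≤ Y (j + 1) := by rw [hYs]; linarith
      refine Complex.integral_boundary_rect_eq_zero_of_continuousOn_of_differentiableOn F
        ⟨X i, Y j⟩ ⟨X (i + 1), Y (j + 1)⟩ hF.continuousOn fun z hz => ?_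
      simp only [min_eq_left hXle, max_eq_right hXle, min_eq_left hYle, max_eq_right hYle] at hz
      refine (hd z ⟨⟨hi.1.trans_lt hz.1.1, hz.1.2.trans_le hi.2⟩,
        ⟨hj.1.trans_lt hz.2.1, hz.2.2.trans_le hj.2⟩⟩ fun hzΓ => ?_).differentiableWithinAt
      exact hno z hzΓ (Ioo_subset_Icc_self hz.1) (Ioo_subset_Icc_self hz.2)
    have hbound : ∀ p ∈ S, ‖G p‖ ≤ ε * (h + k) := by
      rintro ⟨i, j⟩ hp
      have hp' := Finset.mem_product.1 (Finset.mem_filter.1 hp).1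
      have hi := hX i (Finset.mem_range.1 hp'.1)
      have hj := hY j (Finset.mem_range.1 hp'.2)
      have hXle : X i ≤ X (i + 1) := by rw [hXs]; linarith
      have hYle : Y j ≤ Y (j + 1) := by rw [hYs]; linarith
      have hsmall : h + k = (X (i + 1) - X i) + (Y (j + 1) - Y j) := by rw [hXs, hYs]; ring
      rw [hsmall]
      refine norm_rectIntegral_le hF hXle hYle (fun x hx => ?_) (fun y hy => ?_)
      · rw [← dist_eq_norm]
        refine (hFδ _ ?_ _ ?_ ?_).le
        · simp only [mem_reProdIm, add_re, ofReal_re, mul_re, I_re, mul_zero, ofReal_im, I_im,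
            mul_one, sub_self, add_zero, add_im, mul_im, zero_add]
          exact ⟨⟨hi.1.trans hx.1, hx.2.trans hi.2⟩, ⟨hj.1, hYle.trans hj.2⟩⟩
        · simp only [mem_reProdIm, add_re, ofReal_re, mul_re, I_re, mul_zero, ofReal_im, I_im,
            mul_one, sub_self, add_zero, add_im, mul_im, zero_add]
          exact ⟨⟨hi.1.trans hx.1, hx.2.trans hi.2⟩, ⟨hj.1.trans hYle, hj.2⟩⟩
        · have : (x : ℂ) + (Y j : ℝ) * I - (x + (Y (j + 1) : ℝ) * I) = ((-k : ℝ) : ℂ) * I := by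
            rw [hYs]; push_cast; ring
          rw [dist_eq_norm, this, norm_mul, norm_I, mul_one, norm_real, Real.norm_eq_abs, abs_neg,
            abs_of_pos hk0]
          linarith
      · rw [← dist_eq_norm]
        refine (hFδ _ ?_ _ ?_ ?_).le
        · simp only [mem_reProdIm, add_re, ofReal_re, mul_re, I_re, mul_zero, ofReal_im, I_im,
            mul_one, sub_self, add_zero, add_im, mul_im, zero_add]
          exact ⟨⟨hi.1.trans hXle, hi.2⟩, ⟨hj.1.trans hy.1, hy.2.trans hj.2⟩⟩
        · simp only [mem_reProdIm, add_re, ofReal_re, mul_re, I_re, mul_zero, ofReal_im, I_im,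
            mul_one, sub_self, add_zero, add_im, mul_im, zero_add]
          exact ⟨⟨hi.1, hXle.trans hi.2⟩, ⟨hj.1.trans hy.1, hy.2.trans hj.2⟩⟩
        · have : ((X (i + 1) : ℝ) : ℂ) + y * I - ((X i : ℝ) + y * I) = ((h : ℝ) : ℂ) := by
            rw [hXs]; push_cast; ring
          rw [dist_eq_norm, this, norm_real, Real.norm_eq_abs, abs_of_pos hh0]
          linarith
    have hcard : S.card ≤ (m * N + 1) * 16 := by
      refine card_cells_le hg (x₀ := x₀) (y₀ := y₀) hw hv hm0 hmw hmv hN0 S fun p hp => ?_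
      obtain ⟨z, hzΓ, hz1, hz2⟩ := (Finset.mem_filter.1 hp).2
      obtain ⟨t, ht, rfl⟩ := hcov hzΓ
      refine ⟨t, ht, ?_, ?_⟩
      · simpa [X] using hz1
      · simpa [Y] using hz2
    have hS : ∑ p ∈ Finset.range N ×ˢ Finset.range N, G p = ∑ p ∈ S, G p :=
      (Finset.sum_subset (Finset.filter_subset _ _) hgood).symm
    rw [← hsum]
    change ‖∑ p ∈ Finset.range N ×ˢ Finset.range N, G p‖ ≤ _
    rw [hS]
    refine (norm_sum_le_of_le S hbound).trans ?_
    rw [Finset.sum_const, nsmul_eq_mul]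
    have hcard' : (S.card : ℝ) ≤ (m + 1) * N * 16 := by
      have : (S.card : ℝ) ≤ (m * N + 1) * 16 := by exact_mod_cast hcard
      nlinarith
    calc (S.card : ℝ) * (ε * (h + k)) ≤ ((m + 1) * N * 16) * (ε * (h + k)) := by gcongr
      _ = ε * (16 * (m + 1) * (N * h + N * k)) := by ring
      _ = _ := by rw [hNh, hNk]
  have hC : 0 < 16 * ((m : ℝ) + 1) * (w + v) := by positivity
  rw [← norm_le_zero_iff]
  refine le_of_forall_pos_le_add fun η hη => ?_
  rw [zero_add]
  have := main (η / (16 * ((m : ℝ) + 1) * (w + v))) (by positivity)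
  rwa [div_mul_cancel₀ _ hC.ne'] at this

/-- A rectifiable Jordan curve is removable: a function continuous on an open set and holomorphic
off the curve is holomorphic. -/
theorem IsRectifiableJordanCurve.differentiableOn {Γ : Set ℂ} (hΓ : IsRectifiableJordanCurve Γ)
    {U : Set ℂ} (hU : IsOpen U) {f : ℂ → ℂ} (hc : ContinuousOn f U)
    (hd : ∀ z ∈ U, z ∉ Γ → DifferentiableAt ℂ f z) : DifferentiableOn ℂ f U := by
  refine (Complex.isConservativeOn_and_continuousOn_iff_isDifferentiableOn hU).1 ⟨?_, hc⟩
  have main : ∀ x₀ x₁ y₀ y₁ : ℝ, x₀ ≤ x₁ → y₀ ≤ y₁ → Icc x₀ x₁ ×ℂ Icc y₀ y₁ ⊆ U →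
      rectIntegral f x₀ x₁ y₀ y₁ = 0 := by
    intro x₀ x₁ y₀ y₁ hx hy hsub
    rcases hx.eq_or_lt with rfl | hx'
    · simp [rectIntegral]
    rcases hy.eq_or_lt with rfl | hy'
    · simp [rectIntegral]
    -- clamping the coordinates extends `f` continuously from the rectangle to the plane
    let F : ℂ → ℂ := fun z => f ((projIcc x₀ x₁ hx z.re : ℝ) + (projIcc y₀ y₁ hy z.im : ℝ) * I)
    have hFf : ∀ z ∈ Icc x₀ x₁ ×ℂ Icc y₀ y₁, F z = f z := fun z hz => by
      simp only [F, projIcc_of_mem hx hz.1, projIcc_of_mem hy hz.2, re_add_im]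
    have hFc : Continuous F := by
      refine hc.comp_continuous ?_ fun z => hsub ?_
      · have h1 : Continuous fun z : ℂ => ((projIcc x₀ x₁ hx z.re : ℝ) : ℂ) :=
          continuous_ofReal.comp (continuous_subtype_val.comp
            (continuous_projIcc.comp continuous_re))
        have h2 : Continuous fun z : ℂ => ((projIcc y₀ y₁ hy z.im : ℝ) : ℂ) :=
          continuous_ofReal.comp (continuous_subtype_val.comp
            (continuous_projIcc.comp continuous_im))
        exact h1.add (h2.mul continuous_const)
      · simp only [mem_reProdIm, add_re, ofReal_re, mul_re, I_re, mul_zero, ofReal_im, I_im,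
          mul_one, sub_self, add_zero, add_im, mul_im, zero_add]
        exact ⟨(projIcc x₀ x₁ hx z.re).2, (projIcc y₀ y₁ hy z.im).2⟩
    have hFd : ∀ z ∈ Ioo x₀ x₁ ×ℂ Ioo y₀ y₁, z ∉ Γ → DifferentiableAt ℂ F z := fun z hz hzΓ => by
      refine (hd z (hsub ⟨Ioo_subset_Icc_self hz.1, Ioo_subset_Icc_self hz.2⟩)
        hzΓ).congr_of_eventuallyEq ?_
      filter_upwards [(isOpen_Ioo.reProdIm isOpen_Ioo).mem_nhds hz] with u hu
      exact hFf u ⟨Ioo_subset_Icc_self hu.1, Ioo_subset_Icc_self hu.2⟩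
    rw [← rectIntegral_eq_zero hΓ hFc hx' hy' hFd, rectIntegral, rectIntegral]
    have ex : ∀ y ∈ Icc y₀ y₁, ∫ x : ℝ in x₀..x₁, f (x + y * I) =
        ∫ x : ℝ in x₀..x₁, F (x + y * I) := fun y hy'' => by
      refine intervalIntegral.integral_congr fun x hx'' => ?_
      rw [uIcc_of_le hx] at hx''
      exact (hFf _ (by simpa [mem_reProdIm] using And.intro hx'' hy'')).symm
    have ey : ∀ x ∈ Icc x₀ x₁, ∫ y : ℝ in y₀..y₁, f (x + y * I) =
        ∫ y : ℝ in y₀..y₁, F (x + y * I) := fun x hx'' => by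
      refine intervalIntegral.integral_congr fun y hy'' => ?_
      rw [uIcc_of_le hy] at hy''
      exact (hFf _ (by simpa [mem_reProdIm] using And.intro hx'' hy'')).symm
    rw [ex _ (left_mem_Icc.2 hy), ex _ (right_mem_Icc.2 hy), ey _ (left_mem_Icc.2 hx),
      ey _ (right_mem_Icc.2 hx)]
  intro z w hzw
  rw [← add_eq_zero_iff_eq_neg, Complex.wedgeIntegral_add_wedgeIntegral_eq]
  change rectIntegral f z.re w.re z.im w.im = 0
  rw [Complex.Rectangle] at hzw
  rcases le_total z.re w.re with h1 | h1 <;> rcases le_total z.im w.im with h2 | h2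
  · rw [uIcc_of_le h1, uIcc_of_le h2] at hzw
    exact main _ _ _ _ h1 h2 hzw
  · rw [uIcc_of_le h1, uIcc_of_ge h2] at hzw
    rw [rectIntegral_swap_im, main _ _ _ _ h1 h2 hzw, neg_zero]
  · rw [uIcc_of_ge h1, uIcc_of_le h2] at hzw
    rw [rectIntegral_swap_re, main _ _ _ _ h1 h2 hzw, neg_zero]
  · rw [uIcc_of_ge h1, uIcc_of_ge h2] at hzw
    rw [rectIntegral_swap_re, rectIntegral_swap_im, main _ _ _ _ h1 h2 hzw, neg_zero, neg_zero]

end Removable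

/-! ### Interior and exterior of a curve; gluing across it -/

section Gluing

open Complex Set

lemma IsRectifiableJordanCurve.isCompact {Γ : Set ℂ} (hΓ : IsRectifiableJordanCurve Γ) :
    IsCompact Γ := by
  obtain ⟨γ, ⟨K, hK⟩, -, rfl⟩ := hΓ
  exact isCompact_range hK.continuous

lemma isOpen_curveInterior {Γ : Set ℂ} (hΓ : IsClosed Γ) : IsOpen (curveInterior Γ) := by
  refine isOpen_iff_mem_nhds.2 fun z hz => ?_
  filter_upwards [(hΓ.isOpen_compl.connectedComponentIn (x := z)).mem_nhds
    (mem_connectedComponentIn hz.1)] with w hw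
  exact ⟨connectedComponentIn_subset _ _ hw, connectedComponentIn_eq hw ▸ hz.2⟩

lemma isOpen_curveExterior {Γ : Set ℂ} (hΓ : IsClosed Γ) : IsOpen (curveExterior Γ) := by
  refine isOpen_iff_mem_nhds.2 fun z hz => ?_
  filter_upwards [(hΓ.isOpen_compl.connectedComponentIn (x := z)).mem_nhds
    (mem_connectedComponentIn hz.1)] with w hw
  exact ⟨connectedComponentIn_subset _ _ hw, connectedComponentIn_eq hw ▸ hz.2⟩

lemma mem_curveInterior_or_curveExterior {Γ : Set ℂ} {z : ℂ} (hz : z ∉ Γ) :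
    z ∈ curveInterior Γ ∨ z ∈ curveExterior Γ := by
  by_cases h : Bornology.IsBounded (connectedComponentIn Γᶜ z)
  · exact .inl ⟨hz, h⟩
  · exact .inr ⟨hz, h⟩

lemma notMem_curveExterior_of_mem_curveInterior {Γ : Set ℂ} {z : ℂ} (hz : z ∈ curveInterior Γ) :
    z ∉ curveExterior Γ := fun h => h.2 hz.2

/-- Far out, radial rays avoid the curve, so they lie in unbounded components. -/
lemma eventually_mem_curveExterior {Γ : Set ℂ} (hΓ : Bornology.IsBounded Γ) :
    ∀ᶠ z in Bornology.cobounded ℂ, z ∈ curveExterior Γ := by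
  obtain ⟨R, hR⟩ := hΓ.subset_closedBall 0
  filter_upwards [eventually_cobounded_le_norm (max R 0 + 1)] with z hz
  have hz0 : 0 < ‖z‖ := by linarith [le_max_right R 0]
  have hray : ∀ t : ℝ, 1 ≤ t → (t : ℂ) * z ∈ Γᶜ := fun t ht hmem => by
    have h1 : ‖(t : ℂ) * z‖ ≤ R := by simpa using hR hmem
    rw [norm_mul, norm_real, Real.norm_eq_abs, abs_of_pos (by linarith)] at h1
    nlinarith [le_max_left R 0]
  have hzΓ : z ∈ Γᶜ := by simpa using hray 1 le_rfl
  refine ⟨hzΓ, fun hb => ?_⟩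
  have hsub : (fun t : ℝ => (t : ℂ) * z) '' Ici 1 ⊆ connectedComponentIn Γᶜ z := by
    refine (isPreconnected_Ici.image _ (by fun_prop)).subset_connectedComponentIn
      ⟨1, by simp⟩ ?_
    rintro _ ⟨t, ht, rfl⟩
    exact hray t ht
  obtain ⟨C, hC⟩ := (hb.subset hsub).exists_norm_le
  have h1 := hC _ ⟨max 1 ((C + 1) / ‖z‖), mem_Ici.2 (le_max_left _ _), rfl⟩
  rw [norm_mul, norm_real, Real.norm_eq_abs, abs_of_pos (by positivity)] at h1
  have h2 : (C + 1) / ‖z‖ * ‖z‖ ≤ max 1 ((C + 1) / ‖z‖) * ‖z‖ := by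
    gcongr
    exact le_max_right _ _
  rw [div_mul_cancel₀ _ hz0.ne'] at h2
  linarith

open Classical in
/-- The function equal to `u` inside the curve, to `v` outside, and to `b` on it. -/
def glueAcross (Γ : Set ℂ) (u v b : ℂ → ℂ) (z : ℂ) : ℂ :=
  if z ∈ Γ then b z else if z ∈ curveInterior Γ then u z else v z

lemma glueAcross_of_mem {Γ : Set ℂ} {u v b : ℂ → ℂ} {z : ℂ} (hz : z ∈ Γ) :
    glueAcross Γ u v b z = b z := if_pos hz

lemma glueAcross_of_mem_interior {Γ : Set ℂ} {u v b : ℂ → ℂ} {z : ℂ} (hz : z ∈ curveInterior Γ) :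
    glueAcross Γ u v b z = u z := by
  rw [glueAcross, if_neg hz.1, if_pos hz]

lemma glueAcross_of_mem_exterior {Γ : Set ℂ} {u v b : ℂ → ℂ} {z : ℂ} (hz : z ∈ curveExterior Γ) :
    glueAcross Γ u v b z = v z := by
  rw [glueAcross, if_neg hz.1, if_neg fun h => notMem_curveExterior_of_mem_curveInterior h hz]

/-- Analytic continuation across a rectifiable curve along which the boundary values agree. -/
lemma differentiableOn_glueAcross {Γ : Set ℂ} (hΓ : IsRectifiableJordanCurve Γ) {U : Set ℂ}
    (hU : IsOpen U) {u v b : ℂ → ℂ} (hb : ContinuousOn b Γ)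
    (hu : ∀ z ∈ U, z ∈ curveInterior Γ → DifferentiableAt ℂ u z)
    (hv : ∀ z ∈ U, z ∈ curveExterior Γ → DifferentiableAt ℂ v z)
    (hub : ∀ s ∈ Γ, Tendsto u (𝓝[curveInterior Γ] s) (𝓝 (b s)))
    (hvb : ∀ s ∈ Γ, Tendsto v (𝓝[curveExterior Γ] s) (𝓝 (b s))) :
    DifferentiableOn ℂ (glueAcross Γ u v b) U := by
  have hcl := hΓ.isCompact.isClosed
  have hd : ∀ z ∈ U, z ∉ Γ → DifferentiableAt ℂ (glueAcross Γ u v b) z := fun z hzU hz => by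
    rcases mem_curveInterior_or_curveExterior hz with h | h
    · refine (hu z hzU h).congr_of_eventuallyEq ?_
      filter_upwards [(isOpen_curveInterior hcl).mem_nhds h] with w hw
      exact glueAcross_of_mem_interior hw
    · refine (hv z hzU h).congr_of_eventuallyEq ?_
      filter_upwards [(isOpen_curveExterior hcl).mem_nhds h] with w hw
      exact glueAcross_of_mem_exterior hw
  refine hΓ.differentiableOn hU (fun z hzU => ?_) hd
  by_cases hz : z ∈ Γ
  · refine ContinuousAt.continuousWithinAt ?_
    have huniv : Γ ∪ (curveInterior Γ ∪ curveExterior Γ) = univ := by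
      refine eq_univ_of_forall fun w => ?_
      by_cases hw : w ∈ Γ
      · exact .inl hw
      · exact .inr (mem_curveInterior_or_curveExterior hw)
    rw [ContinuousAt, ← nhdsWithin_univ, ← huniv, nhdsWithin_union, nhdsWithin_union,
      tendsto_sup, tendsto_sup, glueAcross_of_mem hz]
    refine ⟨(hb z hz).congr' ?_, (hub z hz).congr' ?_, (hvb z hz).congr' ?_⟩
    · filter_upwards [self_mem_nhdsWithin] with w hw using (glueAcross_of_mem hw).symm
    · filter_upwards [self_mem_nhdsWithin] with w hw using (glueAcross_of_mem_interior hw).symm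
    · filter_upwards [self_mem_nhdsWithin] with w hw using (glueAcross_of_mem_exterior hw).symm
  · exact (hd z hzU hz).continuousAt.continuousWithinAt

/-- Liouville's theorem for polynomial growth. -/
lemma exists_polynomial_of_isBigO {f : ℂ → ℂ} (hf : Differentiable ℂ f) {d : ℕ}
    (h : f =O[Bornology.cobounded ℂ] fun z => z ^ d) :
    ∃ P : Polynomial ℂ, P.natDegree ≤ d ∧ ∀ z, f z = P.eval z := by
  induction d generalizing f with
  | zero =>
    have hb : Bornology.IsBounded (range f) := by
      obtain ⟨C, hC⟩ := h.bound
      obtain ⟨R, -, hR⟩ := (hasBasis_cobounded_norm.eventually_iff).1 hC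
      obtain ⟨B, hB⟩ := (isCompact_closedBall (0 : ℂ) R).exists_bound_of_continuousOn
        hf.continuous.continuousOn
      refine (isBounded_iff_forall_norm_le).2 ⟨max C B, ?_⟩
      rintro _ ⟨z, rfl⟩
      rcases le_total R ‖z‖ with hz | hz
      · exact (by simpa using hR hz : ‖f z‖ ≤ C).trans (le_max_left _ _)
      · exact (hB z (by simpa using hz)).trans (le_max_right _ _)
    exact ⟨.C (f 0), by simp, fun z => by
      rw [Polynomial.eval_C]; exact hf.apply_eq_apply_of_bounded hb z 0⟩
  | succ d ih =>
    have hg : Differentiable ℂ (dslope f 0) := by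
      rw [← differentiableOn_univ] at hf ⊢
      exact (Complex.differentiableOn_dslope univ_mem).2 hf
    have hne : ∀ᶠ z : ℂ in Bornology.cobounded ℂ, 1 ≤ ‖z‖ := eventually_cobounded_le_norm 1
    have hgO : dslope f 0 =O[Bornology.cobounded ℂ] fun z => z ^ d := by
      have h1 : (fun z => f z - f 0) =O[Bornology.cobounded ℂ] fun z : ℂ => z ^ (d + 1) := by
        refine h.sub (Asymptotics.IsBigO.of_bound ‖f 0‖ ?_)
        filter_upwards [hne] with z hz
        rw [norm_pow]
        exact le_mul_of_one_le_right (norm_nonneg _) (one_le_pow₀ hz)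
      have h2 := (Asymptotics.isBigO_refl (fun z : ℂ => z⁻¹) (Bornology.cobounded ℂ)).mul h1
      refine h2.congr' ?_ ?_
      · filter_upwards [hne] with z hz
        have hz0 : z ≠ 0 := norm_pos_iff.1 (by linarith)
        rw [dslope_of_ne _ hz0, slope_def_field, sub_zero, div_eq_inv_mul]
      · filter_upwards [hne] with z hz
        have hz0 : z ≠ 0 := norm_pos_iff.1 (by linarith)
        rw [pow_succ']
        field_simp
    obtain ⟨P, hPd, hP⟩ := ih hg hgO
    refine ⟨.X * P + .C (f 0), ?_, fun z => ?_⟩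
    · rw [Polynomial.natDegree_add_C]
      refine Polynomial.natDegree_mul_le.trans ?_
      rw [Polynomial.natDegree_X]
      omega
    · have := sub_smul_dslope f 0 z
      rw [Polynomial.eval_add, Polynomial.eval_mul, Polynomial.eval_X, Polynomial.eval_C, ← hP]
      rw [sub_zero, smul_eq_mul] at this
      rw [this]
      ring

end Gluing

/-! ### Residues along the lattice `q^ℕ` -/

section Residues

open Complex Set Metric

/-- The residue theorem for an annulus containing a single simple pole. -/
lemma circleIntegral_sub_eq_of_simple_pole {g : ℂ → ℂ} {p c : ℂ} {r R : ℝ} (hr : 0 < r)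
    (hrp : r < ‖p‖) (hpR : ‖p‖ < R)
    (hg : ∀ z, r ≤ ‖z‖ → ‖z‖ ≤ R → z ≠ p → DifferentiableAt ℂ g z)
    (hp : Tendsto (fun z => (z - p) * g z) (𝓝[≠] p) (𝓝 c)) :
    (∮ z in C(0, R), g z) - (∮ z in C(0, r), g z) = 2 * Real.pi * I * c := by
  classical
  let φ : ℂ → ℂ := Function.update (fun z => (z - p) * g z) p c
  have hφp : φ p = c := Function.update_self ..
  have hφ : ∀ z, z ≠ p → φ z = (z - p) * g z := fun z hz => Function.update_of_ne hz _ _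
  have hφne : ∀ z, r ≤ ‖z‖ → ‖z‖ ≤ R → z ≠ p → DifferentiableAt ℂ φ z := fun z h1 h2 hz => by
    refine (((differentiableAt_id.sub_const p).mul (hg z h1 h2 hz))).congr_of_eventuallyEq ?_
    filter_upwards [isOpen_ne.mem_nhds hz] with w hw using hφ w hw
  have hO : {z : ℂ | r < ‖z‖ ∧ ‖z‖ < R} ∈ 𝓝 p :=
    ((isOpen_lt continuous_const continuous_norm).inter
      (isOpen_lt continuous_norm continuous_const)).mem_nhds ⟨hrp, hpR⟩
  have hφO : DifferentiableOn ℂ φ {z : ℂ | r < ‖z‖ ∧ ‖z‖ < R} := by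
    refine (Complex.differentiableOn_compl_singleton_and_continuousAt_iff hO).1 ⟨?_, ?_⟩
    · exact fun z hz => (hφne z hz.1.1.le hz.1.2.le hz.2).differentiableWithinAt
    · exact continuousAt_update_same.2 hp
  have hφd : ∀ z, r ≤ ‖z‖ → ‖z‖ ≤ R → DifferentiableAt ℂ φ z := fun z h1 h2 => by
    rcases eq_or_ne z p with rfl | hz
    · exact hφO.differentiableAt hO
    · exact hφne z h1 h2 hz
  -- `dslope φ p` is the regular part `g - c / (z - p)`
  have hψ : ∀ z, r ≤ ‖z‖ → ‖z‖ ≤ R → DifferentiableAt ℂ (dslope φ p) z := fun z h1 h2 => by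
    rcases eq_or_ne z p with rfl | hz
    · exact ((Complex.differentiableOn_dslope hO).2 hφO).differentiableAt hO
    · exact (differentiableAt_dslope_of_ne hz).2 (hφd z h1 h2)
  have hgz : ∀ z, z ≠ p → g z = dslope φ p z + c * (z - p)⁻¹ := fun z hz => by
    have hzp : z - p ≠ 0 := sub_ne_zero.2 hz
    rw [dslope_of_ne _ hz, slope_def_field, hφp, hφ z hz]
    field_simp
    ring
  have hR : 0 < R := hr.trans (hrp.trans hpR)
  have hcirc : ∀ ρ, r ≤ ρ → ρ ≤ R → ρ ≠ ‖p‖ →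
      (∮ z in C(0, ρ), g z) = (∮ z in C(0, ρ), dslope φ p z) + c * ∮ z in C(0, ρ), (z - p)⁻¹ := by
    intro ρ h1 h2 h3
    have hρ : 0 < ρ := hr.trans_le h1
    have hns : p ∉ sphere (0 : ℂ) |ρ| := by
      rw [abs_of_pos hρ, mem_sphere_zero_iff_norm]
      exact h3.symm
    rw [circleIntegral.integral_congr hρ.le (g := fun z => dslope φ p z + c * (z - p)⁻¹),
      circleIntegral.integral_add, circleIntegral.integral_const_mul]
    · refine ContinuousOn.circleIntegrable hρ.le fun z hz => ?_
      rw [mem_sphere_zero_iff_norm] at hz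
      exact (hψ z (hz ▸ h1) (hz ▸ h2)).continuousAt.continuousWithinAt
    · refine (circleIntegrable_sub_inv_iff.2 (.inr hns)).const_fun_smul (a := c)
    · intro z hz
      refine hgz z ?_
      rintro rfl
      exact hns (by rwa [abs_of_pos hρ])
  have hreg : (∮ z in C(0, R), dslope φ p z) = ∮ z in C(0, r), dslope φ p z := by
    refine Complex.circleIntegral_eq_of_differentiable_on_annulus_off_countable hr
      (hrp.trans hpR).le countable_empty (fun z hz => ?_) fun z hz => ?_
    · simp only [Set.mem_sdiff, mem_closedBall, dist_zero_right, mem_ball, not_lt] at hz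
      exact (hψ z hz.2 hz.1).continuousAt.continuousWithinAt
    · simp only [Set.mem_sdiff, mem_closedBall, dist_zero_right, mem_ball, not_le] at hz
      exact hψ z hz.1.2.le hz.1.1.le
  have hout : (∮ z in C(0, R), (z - p)⁻¹) = 2 * Real.pi * I :=
    circleIntegral.integral_sub_inv_of_mem_ball (by simpa using hpR)
  have hin : (∮ z in C(0, r), (z - p)⁻¹) = 0 := by
    refine Complex.circleIntegral_eq_zero_of_differentiable_on_off_countable hr.le countable_empty
      (fun z hz => ?_) fun z hz => ?_
    · have hzp : z ≠ p := fun h => by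
        rw [mem_closedBall, dist_zero_right, h] at hz
        linarith
      exact ContinuousAt.continuousWithinAt
        (ContinuousAt.inv₀ (f := fun z => z - p) (by fun_prop) (sub_ne_zero.2 hzp))
    · have hzp : z ≠ p := fun h => by
        have := hz.1
        rw [mem_ball, dist_zero_right, h] at this
        linarith
      exact DifferentiableAt.inv (by fun_prop) (sub_ne_zero.2 hzp)
  rw [hcirc R (hrp.trans hpR).le le_rfl hpR.ne', hcirc r le_rfl (hrp.trans hpR).le hrp.ne, hreg,
    hout, hin]
  ring

/-- The midpoint of `q^N` and `q^{N-1}`, the radius of a circle separating these two points. -/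
def sepRadius (q : ℝ) (N : ℕ) : ℝ := q ^ N * ((1 + q⁻¹) / 2)

variable {q : ℝ}

lemma one_lt_mid (hq0 : 0 < q) (hq1 : q < 1) : 1 < (1 + q⁻¹) / 2 := by
  have := (one_lt_inv₀ hq0).2 hq1
  linarith

lemma mid_mul_lt (hq0 : 0 < q) (hq1 : q < 1) : q * ((1 + q⁻¹) / 2) < 1 := by
  have : q * ((1 + q⁻¹) / 2) = (q + 1) / 2 := by field_simp
  linarith

lemma sepRadius_pos (hq0 : 0 < q) (N : ℕ) : 0 < sepRadius q N := by
  unfold sepRadius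
  positivity

lemma pow_lt_sepRadius (hq0 : 0 < q) (hq1 : q < 1) (N : ℕ) : q ^ N < sepRadius q N :=
  lt_mul_of_one_lt_right (pow_pos hq0 N) (one_lt_mid hq0 hq1)

lemma sepRadius_succ_lt (hq0 : 0 < q) (hq1 : q < 1) (N : ℕ) : sepRadius q (N + 1) < q ^ N := by
  rw [sepRadius, pow_succ, mul_assoc]
  exact mul_lt_of_lt_one_right (pow_pos hq0 N) (mid_mul_lt hq0 hq1)

lemma norm_ofReal_pow (hq0 : 0 < q) (k : ℕ) : ‖(q : ℂ) ^ k‖ = q ^ k := by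
  rw [norm_pow, norm_real, Real.norm_eq_abs, abs_of_pos hq0]

/-- The complement of `{0} ∪ q^ℕ`. -/
def offHalfLattice (q : ℝ) : Set ℂ := {z | z ≠ 0 ∧ ∀ k : ℕ, z ≠ (q : ℂ) ^ k}

lemma isOpen_offHalfLattice (hq0 : 0 < q) (hq1 : q < 1) : IsOpen (offHalfLattice q) := by
  have h : Tendsto (fun k : ℕ => (q : ℂ) ^ k) atTop (𝓝 0) :=
    tendsto_pow_atTop_nhds_zero_of_norm_lt_one (by simpa [abs_of_pos hq0] using hq1)
  have hc := h.isCompact_insert_range.isClosed.isOpen_compl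
  convert hc using 1
  ext z
  simp only [offHalfLattice, mem_ofPred_eq, mem_compl_iff, mem_insert_iff, mem_range, not_or,
    not_exists]
  exact and_congr_right fun _ => forall_congr' fun k => ne_comm

/-- On each bounded set the full lattice is a dilate of the half lattice. -/
lemma isOpen_offLattice (hq0 : 0 < q) (hq1 : q < 1) : IsOpen (offLattice q) := by
  have hqc : (q : ℂ) ≠ 0 := by exact_mod_cast hq0.ne'
  refine isOpen_iff_mem_nhds.2 fun z hz => ?_
  obtain ⟨N, hN⟩ := exists_pow_lt_of_lt_one (inv_pos.2 (by positivity : 0 < ‖z‖ + 1)) hq1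
  have hmem : z * (q : ℂ) ^ N ∈ offHalfLattice q := by
    refine ⟨mul_ne_zero hz.1 (pow_ne_zero _ hqc), fun k hk => hz.2 (k - N) ?_⟩
    rw [zpow_sub₀ hqc, zpow_natCast, zpow_natCast, ← hk, mul_div_cancel_right₀ _
      (pow_ne_zero _ hqc)]
  have h1 : ∀ᶠ w in 𝓝 z, w * (q : ℂ) ^ N ∈ offHalfLattice q :=
    (continuous_mul_const ((q : ℂ) ^ N)).continuousAt.eventually
      ((isOpen_offHalfLattice hq0 hq1).mem_nhds hmem)
  have h2 : ∀ᶠ w in 𝓝 z, ‖w‖ < ‖z‖ + 1 :=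
    continuous_norm.continuousAt.eventually_lt_const (by linarith)
  filter_upwards [h1, h2] with w hw1 hw2
  refine ⟨fun h => hw1.1 (by rw [h, zero_mul]), fun k hk => ?_⟩
  rcases le_or_gt 0 (k + N) with hkN | hkN
  · refine hw1.2 (k + N).toNat ?_
    rw [hk, ← zpow_natCast, ← zpow_natCast, Int.toNat_of_nonneg hkN, zpow_add₀ hqc]
  · -- here `|w q^N| = q^{k + N} > 1`
    have h3 : ‖w * (q : ℂ) ^ N‖ < 1 := by
      rw [norm_mul, norm_ofReal_pow hq0]
      calc ‖w‖ * q ^ N ≤ (‖z‖ + 1) * q ^ N := by gcongr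
        _ < (‖z‖ + 1) * (‖z‖ + 1)⁻¹ := by gcongr
        _ = 1 := mul_inv_cancel₀ (by positivity)
    rw [hk, ← zpow_natCast, ← zpow_add₀ hqc, norm_zpow, norm_real, Real.norm_eq_abs,
      abs_of_pos hq0] at h3
    exact absurd h3 (not_lt.2 (one_lt_zpow_of_neg₀ hq0 hq1 hkN).le)

/-- Summing the residues between successive separating circles. -/
lemma circleIntegral_sub_eq_sum {g : ℂ → ℂ} {c : ℕ → ℂ} (hq0 : 0 < q) (hq1 : q < 1)
    (hg : DifferentiableOn ℂ g (offHalfLattice q))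
    (hc : ∀ k : ℕ, Tendsto (fun z => (z - (q : ℂ) ^ k) * g z) (𝓝[≠] ((q : ℂ) ^ k)) (𝓝 (c k)))
    (N : ℕ) :
    (∮ z in C(0, sepRadius q 0), g z) - (∮ z in C(0, sepRadius q N), g z) =
      2 * Real.pi * I * ∑ k ∈ Finset.range N, c k := by
  induction N with
  | zero => simp
  | succ N ih =>
    have h := circleIntegral_sub_eq_of_simple_pole (g := g) (p := (q : ℂ) ^ N) (c := c N)
      (sepRadius_pos hq0 (N + 1)) (by rw [norm_ofReal_pow hq0]; exact sepRadius_succ_lt hq0 hq1 N)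
      (by rw [norm_ofReal_pow hq0]; exact pow_lt_sepRadius hq0 hq1 N) (fun z h1 h2 h3 => by
        refine hg.differentiableAt ((isOpen_offHalfLattice hq0 hq1).mem_nhds ⟨?_, fun k hk => ?_⟩)
        · rintro rfl
          rw [norm_zero] at h1
          exact absurd h1 (not_le.2 (sepRadius_pos hq0 _))
        · rw [hk, norm_ofReal_pow hq0] at h1 h2
          have hkN : k ≠ N := fun h => h3 (by rw [hk, h])
          rcases lt_or_gt_of_ne hkN with hlt | hgt
          · obtain ⟨M, rfl⟩ := Nat.exists_eq_add_of_lt hlt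
            have h4 : q ^ (k + M + 1) ≤ q ^ (k + 1) :=
              pow_le_pow_of_le_one hq0.le hq1.le (by omega)
            have h5 := sepRadius_succ_lt hq0 hq1 k
            have h6 : sepRadius q (k + M + 1) ≤ sepRadius q (k + 1) := by
              unfold sepRadius
              gcongr
            linarith
          · have h4 : q ^ k ≤ q ^ (N + 1) := pow_le_pow_of_le_one hq0.le hq1.le hgt
            have h5 := pow_lt_sepRadius hq0 hq1 (N + 1)
            linarith) (hc N)
    rw [Finset.sum_range_succ, mul_add, ← ih, ← h]
    ring

/-- Pushing the contour to infinity: for a function that is `κ / z + O(z^{-2})` there, only the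
term `κ / z` contributes. -/
lemma circleIntegral_eq_of_isBigO {g : ℂ → ℂ} {κ : ℂ} (hq0 : 0 < q) (hq1 : q < 1)
    (hg : DifferentiableOn ℂ g (offHalfLattice q))
    (h : (fun z => g z - κ * z⁻¹) =O[Bornology.cobounded ℂ] fun z => z⁻¹ ^ 2) :
    (∮ z in C(0, sepRadius q 0), g z) = 2 * Real.pi * I * κ := by
  have hρ := sepRadius_pos hq0 0
  have hρ1 : 1 < sepRadius q 0 := by simpa using pow_lt_sepRadius hq0 hq1 0
  have hgd : ∀ z, sepRadius q 0 ≤ ‖z‖ → DifferentiableAt ℂ g z := fun z hz => by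
    refine hg.differentiableAt ((isOpen_offHalfLattice hq0 hq1).mem_nhds ⟨?_, fun k hk => ?_⟩)
    · rintro rfl
      rw [norm_zero] at hz
      linarith
    · rw [hk, norm_ofReal_pow hq0] at hz
      linarith [pow_le_one₀ hq0.le hq1.le (n := k)]
  obtain ⟨C, hC⟩ := h.bound
  obtain ⟨R₀, -, hR₀⟩ := (hasBasis_cobounded_norm.eventually_iff).1 hC
  have hbig : ∀ R, max R₀ (sepRadius q 0) ≤ R →
      ‖(∮ z in C(0, sepRadius q 0), g z) - 2 * Real.pi * I * κ‖ ≤ 2 * Real.pi * C * R⁻¹ := by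
    intro R hR
    have hR1 : sepRadius q 0 ≤ R := (le_max_right _ _).trans hR
    have hRpos : 0 < R := hρ.trans_le hR1
    have e1 : (∮ z in C(0, R), g z) = ∮ z in C(0, sepRadius q 0), g z := by
      refine Complex.circleIntegral_eq_of_differentiable_on_annulus_off_countable hρ hR1
        countable_empty (fun z hz => ?_) fun z hz => ?_
      · simp only [Set.mem_sdiff, mem_closedBall, dist_zero_right, mem_ball, not_lt] at hz
        exact (hgd z hz.2).continuousAt.continuousWithinAt
      · simp only [Set.mem_sdiff, mem_closedBall, dist_zero_right, mem_ball, not_le] at hz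
        exact hgd z hz.1.2.le
    have e2 : (∮ z in C(0, R), κ * z⁻¹) = 2 * Real.pi * I * κ := by
      have := circleIntegral.integral_sub_inv_of_mem_ball (c := 0) (w := 0) (R := R)
        (by simpa using hRpos)
      simp only [sub_zero] at this
      rw [circleIntegral.integral_const_mul, this]
      ring
    have i1 : CircleIntegrable g 0 R := ContinuousOn.circleIntegrable hRpos.le fun z hz => by
      rw [mem_sphere_zero_iff_norm] at hz
      exact (hgd z (hz ▸ hR1)).continuousAt.continuousWithinAt
    have i2 : CircleIntegrable (fun z => κ * z⁻¹) 0 R :=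
      ContinuousOn.circleIntegrable hRpos.le fun z hz => by
        rw [mem_sphere_zero_iff_norm] at hz
        have hz0 : z ≠ 0 := norm_pos_iff.1 (hz ▸ hRpos)
        exact (continuousAt_const.mul (continuousAt_inv₀ hz0)).continuousWithinAt
    rw [← e1, ← e2, ← circleIntegral.integral_sub i1 i2]
    refine (circleIntegral.norm_integral_le_of_norm_le_const hRpos.le (C := C * R⁻¹ ^ 2)
      fun z hz => ?_).trans (le_of_eq ?_)
    · rw [mem_sphere_zero_iff_norm] at hz
      have := hR₀ (x := z) (by
        change R₀ ≤ ‖z‖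
        rw [hz]
        exact (le_max_left _ _).trans hR)
      rwa [norm_pow, norm_inv, hz] at this
    · field_simp
  have hlim : Tendsto (fun R : ℝ => 2 * Real.pi * C * R⁻¹) atTop (𝓝 0) := by
    simpa using tendsto_inv_atTop_zero.const_mul (2 * Real.pi * C)
  have h0 := ge_of_tendsto hlim ((eventually_ge_atTop _).mono hbig)
  exact sub_eq_zero.1 (norm_le_zero_iff.1 h0)

/-- The sum of all residues on `q^ℕ`, for a function `κ / z + O(z^{-2})` at infinity whose
integrals over small separating circles tend to zero. -/
lemma tendsto_sum_residues {g : ℂ → ℂ} {c : ℕ → ℂ} {κ : ℂ} (hq0 : 0 < q) (hq1 : q < 1)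
    (hg : DifferentiableOn ℂ g (offHalfLattice q))
    (hc : ∀ k : ℕ, Tendsto (fun z => (z - (q : ℂ) ^ k) * g z) (𝓝[≠] ((q : ℂ) ^ k)) (𝓝 (c k)))
    (h : (fun z => g z - κ * z⁻¹) =O[Bornology.cobounded ℂ] fun z => z⁻¹ ^ 2)
    (h0 : Tendsto (fun N => ∮ z in C(0, sepRadius q N), g z) atTop (𝓝 0)) :
    Tendsto (fun N => ∑ k ∈ Finset.range N, c k) atTop (𝓝 κ) := by
  have h1 := (h0.const_sub (2 * Real.pi * I * κ)).const_mul (2 * Real.pi * I)⁻¹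
  rw [sub_zero, inv_mul_cancel_left₀ Complex.two_pi_I_ne_zero] at h1
  refine h1.congr fun N => ?_
  rw [← circleIntegral_eq_of_isBigO hq0 hq1 hg h, circleIntegral_sub_eq_sum hq0 hq1 hg hc N,
    inv_mul_cancel_left₀ Complex.two_pi_I_ne_zero]

end Residues

/-! ### The `q`-periodic kernel and the second and third columns -/

section Kernel

open Complex Set Metric

variable {q α : ℝ} {h : ℂ → ℂ}

lemma mul_mem_offLattice (hq0 : 0 < q) {w : ℂ} (hw : w ∈ offLattice q) :
    (q : ℂ) * w ∈ offLattice q := by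
  have hqc : (q : ℂ) ≠ 0 := by exact_mod_cast hq0.ne'
  refine ⟨mul_ne_zero hqc hw.1, fun k hk => hw.2 (k - 1) ?_⟩
  rw [zpow_sub_one₀ hqc, ← hk]
  field_simp

lemma eventually_mem_offLattice (hq0 : 0 < q) (hq1 : q < 1) (k : ℕ) :
    ∀ᶠ w in 𝓝[≠] ((q : ℂ) ^ k), w ∈ offLattice q := by
  have hqc : (q : ℂ) ≠ 0 := by exact_mod_cast hq0.ne'
  have hn : ‖(q : ℂ) ^ k‖ = q ^ (k : ℤ) := by rw [norm_ofReal_pow hq0, zpow_natCast]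
  have h1 : ∀ᶠ w in 𝓝 ((q : ℂ) ^ k), q ^ ((k : ℤ) + 1) < ‖w‖ := by
    refine continuous_norm.continuousAt.eventually_const_lt ?_
    change q ^ ((k : ℤ) + 1) < ‖(q : ℂ) ^ k‖
    rw [hn]
    exact zpow_lt_zpow_right_of_lt_one₀ hq0 hq1 (by omega)
  have h2 : ∀ᶠ w in 𝓝 ((q : ℂ) ^ k), ‖w‖ < q ^ ((k : ℤ) - 1) := by
    refine continuous_norm.continuousAt.eventually_lt_const ?_
    change ‖(q : ℂ) ^ k‖ < q ^ ((k : ℤ) - 1)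
    rw [hn]
    exact zpow_lt_zpow_right_of_lt_one₀ hq0 hq1 (by omega)
  filter_upwards [self_mem_nhdsWithin, mem_nhdsWithin_of_mem_nhds h1,
    mem_nhdsWithin_of_mem_nhds h2] with w hw hw1 hw2
  refine ⟨?_, fun j hj => hw ?_⟩
  · rintro rfl
    rw [norm_zero] at hw1
    exact absurd hw1 (not_lt.2 (by positivity))
  · have hwn : ‖w‖ = q ^ j := by
      rw [hj, norm_zpow, norm_real, Real.norm_eq_abs, abs_of_pos hq0]
    rw [hwn] at hw1 hw2
    have h3 := (zpow_lt_zpow_iff_right_of_lt_one₀ hq0 hq1).1 hw1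
    have h4 := (zpow_lt_zpow_iff_right_of_lt_one₀ hq0 hq1).1 hw2
    have : j = k := by omega
    rw [mem_singleton_iff, hj, this, zpow_natCast]

/-- The residue of `h_α` at `q^k` is `q^{k (1 + α)}`. -/
lemma IsQPeriodicKernel.residue_pow (hh : IsQPeriodicKernel q α h) (hq0 : 0 < q) (hq1 : q < 1)
    (k : ℕ) :
    Tendsto (fun z => (z - (q : ℂ) ^ k) * h z) (𝓝[≠] ((q : ℂ) ^ k))
      (𝓝 (((q ^ α : ℝ) : ℂ) ^ k * (q : ℂ) ^ k)) := by
  have hqc : (q : ℂ) ≠ 0 := by exact_mod_cast hq0.ne'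
  induction k with
  | zero => simpa using hh.residue_one
  | succ k ih =>
    have hdiv : Tendsto (fun z : ℂ => z / q) (𝓝[≠] ((q : ℂ) ^ (k + 1))) (𝓝[≠] ((q : ℂ) ^ k)) := by
      refine tendsto_nhdsWithin_iff.2 ⟨?_, ?_⟩
      · have : Tendsto (fun z : ℂ => z / q) (𝓝 ((q : ℂ) ^ (k + 1)))
            (𝓝 ((q : ℂ) ^ (k + 1) / q)) := tendsto_id.div_const _
        rw [pow_succ, mul_div_cancel_right₀ _ hqc, ← pow_succ] at this
        exact this.mono_left nhdsWithin_le_nhds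
      · filter_upwards [self_mem_nhdsWithin] with z hz hz'
        refine hz ?_
        rw [mem_singleton_iff] at hz' ⊢
        rw [pow_succ, ← hz', div_mul_cancel₀ _ hqc]
    have h1 := (ih.comp hdiv).const_mul ((q : ℂ) * ((q ^ α : ℝ) : ℂ))
    have e : (q : ℂ) * ((q ^ α : ℝ) : ℂ) * (((q ^ α : ℝ) : ℂ) ^ k * (q : ℂ) ^ k) =
        ((q ^ α : ℝ) : ℂ) ^ (k + 1) * (q : ℂ) ^ (k + 1) := by ring
    rw [e] at h1
    refine h1.congr' ?_
    filter_upwards [hdiv.eventually (eventually_mem_offLattice hq0 hq1 k)] with z hz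
    have h2 := hh.map_mul _ hz
    rw [mul_div_cancel₀ _ hqc] at h2
    simp only [Function.comp_apply]
    rw [h2, pow_succ]
    field_simp

lemma IsQPeriodicKernel.map_pow_mul (hh : IsQPeriodicKernel q α h) (hq0 : 0 < q) {w : ℂ}
    (hw : w ∈ offLattice q) (N : ℕ) :
    (q : ℂ) ^ N * w ∈ offLattice q ∧ h ((q : ℂ) ^ N * w) = ((q ^ α : ℝ) : ℂ) ^ N * h w := by
  induction N with
  | zero => simpa using hw
  | succ N ih =>
    rw [pow_succ', mul_assoc]
    refine ⟨mul_mem_offLattice hq0 ih.1, ?_⟩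
    rw [hh.map_mul _ ih.1, ih.2]
    ring

/-- On the separating circles the kernel is controlled by its values on one of them. -/
lemma IsQPeriodicKernel.exists_bound (hh : IsQPeriodicKernel q α h) (hq0 : 0 < q) (hq1 : q < 1) :
    ∃ M, ∀ (N : ℕ) (z : ℂ), ‖z‖ = sepRadius q N → ‖h z‖ ≤ (q ^ α) ^ N * M := by
  have hqc : (q : ℂ) ≠ 0 := by exact_mod_cast hq0.ne'
  have hS : sphere (0 : ℂ) ((1 + q⁻¹) / 2) ⊆ offLattice q := fun w hw => by
    rw [mem_sphere_zero_iff_norm] at hw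
    have hmid := one_lt_mid hq0 hq1
    refine ⟨?_, fun k hk => ?_⟩
    · rintro rfl
      rw [norm_zero] at hw
      linarith
    · have hwn : ‖w‖ = q ^ k := by
        rw [hk, norm_zpow, norm_real, Real.norm_eq_abs, abs_of_pos hq0]
      rw [hwn] at hw
      rcases le_or_gt 0 k with h0 | h0
      · have := zpow_le_one₀ hq0 hq1.le h0
        linarith
      · have h1 : q ^ (-1 : ℤ) ≤ q ^ k := zpow_le_zpow_right_of_le_one₀ hq0 hq1.le (by omega)
        rw [zpow_neg_one] at h1
        have := (one_lt_inv₀ hq0).2 hq1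
        linarith
  obtain ⟨M, hM⟩ := (isCompact_sphere (0 : ℂ) ((1 + q⁻¹) / 2)).exists_bound_of_continuousOn
    (hh.differentiableOn.continuousOn.mono hS)
  refine ⟨M, fun N z hz => ?_⟩
  have hw : z / (q : ℂ) ^ N ∈ sphere (0 : ℂ) ((1 + q⁻¹) / 2) := by
    rw [mem_sphere_zero_iff_norm, norm_div, norm_ofReal_pow hq0, hz, sepRadius]
    field_simp
  have h1 := (hh.map_pow_mul hq0 (hS hw) N).2
  rw [mul_div_cancel₀ _ (pow_ne_zero _ hqc)] at h1
  rw [h1, norm_mul, norm_pow, norm_real, Real.norm_eq_abs,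
    abs_of_pos (Real.rpow_pos_of_pos hq0 α)]
  gcongr
  exact hM _ hw

lemma IsAppropriateCurve.mem_offLattice_of_mem_interior {Γ : Set ℂ} (hΓ : IsAppropriateCurve q Γ)
    {z : ℂ} (hz : z ∈ curveInterior Γ) (hz' : z ∈ offHalfLattice q) : z ∈ offLattice q := by
  refine ⟨hz'.1, fun k hk => ?_⟩
  rcases le_or_gt 0 k with h0 | h0
  · refine hz'.2 k.toNat ?_
    rw [hk, ← zpow_natCast, Int.toNat_of_nonneg h0]
  · exact notMem_curveExterior_of_mem_curveInterior hz (hk ▸ hΓ.mem_exterior k h0)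

lemma IsAppropriateCurve.mem_offLattice_of_mem {Γ : Set ℂ} (hΓ : IsAppropriateCurve q Γ)
    {z : ℂ} (hz : z ∈ Γ) : z ∈ offLattice q := by
  refine ⟨fun h0 => hΓ.zero_mem.1 (h0 ▸ hz), fun k hk => ?_⟩
  rcases le_or_gt 0 k with h0 | h0
  · exact (hΓ.mem_interior k h0).1 (hk ▸ hz)
  · exact (hΓ.mem_exterior k h0).1 (hk ▸ hz)

/-- The scalar jump problem `u₊ = u₋ + (q s; q)_∞ h_α P`. Its solution, continued into the interior
by adding `(q z; q)_∞ h_α P`, is holomorphic off `{0} ∪ q^ℕ`, where its residues are the terms of a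
Jackson integral; the behaviour at infinity evaluates their sum. -/
lemma jacksonIntegral_eq_of_jump (hq0 : 0 < q) (hq1 : q < 1) (hα : -1 < α)
    (hh : IsQPeriodicKernel q α h) {Γ : Set ℂ} (hΓ : IsAppropriateCurve q Γ) (P : Polynomial ℂ)
    {u um up : ℂ → ℂ} (hu : DifferentiableOn ℂ u Γᶜ) (hup : ContinuousOn up Γ)
    (hm : ∀ s ∈ Γ, Tendsto u (𝓝[curveInterior Γ] s) (𝓝 (um s)))
    (hp : ∀ s ∈ Γ, Tendsto u (𝓝[curveExterior Γ] s) (𝓝 (up s)))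
    (hjump : ∀ s ∈ Γ, up s = um s + qPochInf q (q * s) * h s * P.eval s)
    (j : ℕ) {κ : ℂ}
    (hinf : (fun z => u z * z ^ j - κ * z⁻¹) =O[Bornology.cobounded ℂ] fun z => z⁻¹ ^ 2) :
    jacksonIntegral q
      (fun x => P.eval (x : ℂ) * (x : ℂ) ^ j * littleJacobiWeight q α x) = κ := by
  have hcpt := hΓ.jordan.isCompact
  have hint := isOpen_curveInterior hcpt.isClosed
  have hext := isOpen_curveExterior hcpt.isClosed
  have hud : ∀ z, z ∉ Γ → DifferentiableAt ℂ u z := fun z hz =>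
    hu.differentiableAt (hcpt.isClosed.isOpen_compl.mem_nhds hz)
  have hW : Differentiable ℂ fun z : ℂ => qPochInf q (q * z) :=
    (differentiable_qPochInf hq0 hq1).comp (differentiable_id.const_mul (q : ℂ))
  have hP : Differentiable ℂ fun z : ℂ => P.eval z := P.differentiable
  have hhd : ∀ z ∈ offLattice q, DifferentiableAt ℂ h z := fun z hz =>
    hh.differentiableOn.differentiableAt ((isOpen_offLattice hq0 hq1).mem_nhds hz)
  set v : ℂ → ℂ := fun z => u z + qPochInf q (q * z) * h z * P.eval z with hv
  set G := glueAcross Γ v u up with hG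
  have hGd : DifferentiableOn ℂ G (offHalfLattice q) := by
    refine differentiableOn_glueAcross hΓ.jordan (isOpen_offHalfLattice hq0 hq1) hup
      (fun z hz hzi => ?_) (fun z _ hze => hud z hze.1) (fun s hs => ?_) hp
    · exact (hud z hzi.1).add (((hW z).mul
        (hhd z (hΓ.mem_offLattice_of_mem_interior hzi hz))).mul (hP z))
    · rw [hjump s hs]
      refine (hm s hs).add (Tendsto.mono_left ?_ nhdsWithin_le_nhds)
      exact ((hW s).mul (hhd s (hΓ.mem_offLattice_of_mem hs))).mul (hP s) |>.continuousAt
  have hgd : DifferentiableOn ℂ (fun z => G z * z ^ j) (offHalfLattice q) :=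
    hGd.mul (differentiable_pow j).differentiableOn
  have hsum := hasSum_jackson hq0 hq1 (norm_rpow_mul_lt_one hq0 hq1 hα) j P
  rw [jacksonIntegral_eq hq0 hq1 hα]
  refine tendsto_nhds_unique hsum.tendsto_sum_nat
    (tendsto_sum_residues hq0 hq1 hgd (fun k => ?_) ?_ ?_)
  · have hk : (q : ℂ) ^ k ∈ curveInterior Γ := by
      simpa using hΓ.mem_interior (k : ℤ) (by omega)
    have t1 : Tendsto (fun z : ℂ => (z - (q : ℂ) ^ k) * u z) (𝓝[≠] ((q : ℂ) ^ k))
        (𝓝 (((q : ℂ) ^ k - (q : ℂ) ^ k) * u ((q : ℂ) ^ k))) := by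
      have t0 : ContinuousAt (fun z : ℂ => z - (q : ℂ) ^ k) ((q : ℂ) ^ k) := by fun_prop
      exact (t0.mul (hud _ hk.1).continuousAt).tendsto.mono_left nhdsWithin_le_nhds
    have t2 := hh.residue_pow hq0 hq1 k
    have t3 : Tendsto (fun z : ℂ => qPochInf q (q * z) * P.eval z) (𝓝[≠] ((q : ℂ) ^ k))
        (𝓝 (qPochInf q (q * (q : ℂ) ^ k) * P.eval ((q : ℂ) ^ k))) :=
      ((hW _).mul (hP _)).continuousAt.tendsto.mono_left nhdsWithin_le_nhds
    have t4 : Tendsto (fun z : ℂ => z ^ j) (𝓝[≠] ((q : ℂ) ^ k)) (𝓝 (((q : ℂ) ^ k) ^ j)) :=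
      (continuous_pow j).continuousAt.tendsto.mono_left nhdsWithin_le_nhds
    have t5 := (t1.add (t2.mul t3)).mul t4
    have e : ((((q : ℂ) ^ k - (q : ℂ) ^ k) * u ((q : ℂ) ^ k)) +
        (((q ^ α : ℝ) : ℂ) ^ k * (q : ℂ) ^ k) *
          (qPochInf q (q * (q : ℂ) ^ k) * P.eval ((q : ℂ) ^ k))) * ((q : ℂ) ^ k) ^ j =
        P.eval ((q : ℂ) ^ k) * ((q : ℂ) ^ k) ^ j *
          (((q ^ α : ℝ) : ℂ) ^ k * qPochInf q (q * (q : ℂ) ^ k)) * (q : ℂ) ^ k := by ring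
    rw [e] at t5
    refine t5.congr' ?_
    filter_upwards [mem_nhdsWithin_of_mem_nhds (hint.mem_nhds hk)] with z hz
    rw [hG, glueAcross_of_mem_interior hz, hv]
    ring
  · refine hinf.congr' ?_ (EventuallyEq.refl _ _)
    filter_upwards [eventually_mem_curveExterior hcpt.isBounded] with z hz
    rw [hG, glueAcross_of_mem_exterior hz]
  · -- near `0` only the kernel is unbounded, and `ρ |h_α| = O(q^{(1 + α) N})` on the `N`-th circle
    obtain ⟨r, hr, hrs⟩ := nhds_basis_closedBall.mem_iff.1 (hint.mem_nhds hΓ.zero_mem)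
    obtain ⟨B₁, hB₁⟩ := (isCompact_closedBall (0 : ℂ) r).exists_bound_of_continuousOn
      (f := fun z => u z * z ^ j) fun z hz =>
        ((hud z (hrs hz).1).continuousAt.mul (continuous_pow j).continuousAt).continuousWithinAt
    obtain ⟨B₂, hB₂⟩ := (isCompact_closedBall (0 : ℂ) r).exists_bound_of_continuousOn
      (f := fun z => qPochInf q (q * z) * P.eval z * z ^ j)
      ((hW.continuous.mul hP.continuous).mul (continuous_pow j)).continuousOn
    obtain ⟨M, hM⟩ := hh.exists_bound hq0 hq1
    have ha := Real.rpow_pos_of_pos hq0 α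
    have haq : q ^ α * q < 1 := by
      have := norm_rpow_mul_lt_one hq0 hq1 hα
      rwa [← ofReal_mul, norm_real, Real.norm_eq_abs, abs_of_pos (by positivity)] at this
    have hB₂0 : 0 ≤ B₂ := (norm_nonneg _).trans (hB₂ 0 (by simpa using hr.le))
    have hlim0 : Tendsto (fun N : ℕ => sepRadius q N) atTop (𝓝 0) := by
      simpa [sepRadius] using (tendsto_pow_atTop_nhds_zero_of_lt_one hq0.le hq1).mul_const
        ((1 + q⁻¹) / 2)
    have hlim : Tendsto (fun N : ℕ => 2 * Real.pi * ((1 + q⁻¹) / 2) *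
        (q ^ N * B₁ + (q ^ α * q) ^ N * (B₂ * M))) atTop (𝓝 0) := by
      have h1 := (tendsto_pow_atTop_nhds_zero_of_lt_one hq0.le hq1).mul_const B₁
      have h2 := (tendsto_pow_atTop_nhds_zero_of_lt_one (by positivity) haq).mul_const (B₂ * M)
      simpa using (h1.add h2).const_mul (2 * Real.pi * ((1 + q⁻¹) / 2))
    refine squeeze_zero_norm' ?_ hlim
    filter_upwards [hlim0.eventually_lt_const hr] with N hN
    refine (circleIntegral.norm_integral_le_of_norm_le_const (sepRadius_pos hq0 N).le
      (C := B₁ + B₂ * ((q ^ α) ^ N * M)) fun z hz => ?_).trans (le_of_eq ?_)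
    · rw [mem_sphere_zero_iff_norm] at hz
      have hzr : z ∈ closedBall (0 : ℂ) r := by
        rw [mem_closedBall_zero_iff, hz]
        exact hN.le
      have e : G z * z ^ j = u z * z ^ j + (qPochInf q (q * z) * P.eval z * z ^ j) * h z := by
        rw [hG, glueAcross_of_mem_interior (hrs hzr), hv]
        ring
      change ‖G z * z ^ j‖ ≤ _
      rw [e]
      refine (norm_add_le _ _).trans (add_le_add (hB₁ z hzr) ?_)
      rw [norm_mul]
      exact mul_le_mul (hB₂ z hzr) (hM N z hz) (norm_nonneg _) hB₂0
    · rw [sepRadius, mul_pow]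
      ring

end Kernel

/-! ### The first column of the Riemann-Hilbert problem -/

section RHP

open Complex Set

lemma isBigO_mul_pow_sub_inv {u : ℂ → ℂ} {n : ℕ} {δ : ℂ}
    (h : (fun z => u z * z ^ n - δ) =O[Bornology.cobounded ℂ] fun z => z⁻¹) {j : ℕ} (hj : j < n) :
    (fun z => u z * z ^ j - (if j + 1 = n then δ else 0) * z⁻¹) =O[Bornology.cobounded ℂ]
      fun z => z⁻¹ ^ 2 := by
  have hne : ∀ᶠ z : ℂ in Bornology.cobounded ℂ, 1 ≤ ‖z‖ := eventually_cobounded_le_norm 1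
  have hI := Asymptotics.isBigO_refl (fun z : ℂ => z⁻¹) (Bornology.cobounded ℂ)
  split_ifs with hjn
  · refine (h.mul hI).congr' ?_ (.of_forall fun z => (sq _).symm)
    filter_upwards [hne] with z hz
    have hz0 : z ≠ 0 := norm_pos_iff.1 (by linarith)
    rw [← hjn, pow_succ]
    field_simp
  · have h1 : (fun z => u z * z ^ n) =O[Bornology.cobounded ℂ] fun _ => (1 : ℂ) := by
      have h2 : (fun z : ℂ => z⁻¹) =O[Bornology.cobounded ℂ] fun _ => (1 : ℂ) := by
        refine Asymptotics.IsBigO.of_bound 1 ?_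
        filter_upwards [hne] with z hz
        rw [norm_inv, norm_one, mul_one]
        exact inv_le_one_of_one_le₀ hz
      have := (h.trans h2).add (Asymptotics.isBigO_const_const δ (one_ne_zero (α := ℂ)) _)
      simpa using this
    obtain ⟨m, rfl⟩ : ∃ m, n = j + (m + 2) := ⟨n - j - 2, by omega⟩
    have h3 : (fun z : ℂ => z⁻¹ ^ (m + 2)) =O[Bornology.cobounded ℂ] fun z => z⁻¹ ^ 2 := by
      refine Asymptotics.IsBigO.of_bound 1 ?_
      filter_upwards [hne] with z hz
      rw [norm_pow, norm_pow, one_mul, norm_inv]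
      exact pow_le_pow_of_le_one (by positivity) (inv_le_one_of_one_le₀ hz) (by omega)
    refine (h1.mul h3).congr' ?_ (.of_forall fun z => one_mul _)
    filter_upwards [hne] with z hz
    have hz0 : z ≠ 0 := norm_pos_iff.1 (by linarith)
    rw [pow_add z j, zero_mul, sub_zero, mul_assoc, mul_assoc, ← mul_pow, mul_inv_cancel₀ hz0,
      one_pow, mul_one]

/-- Each row of a solution of the Riemann-Hilbert problem: its first entry has no jump, hence is a
polynomial, and the second and third entries encode the moments of that polynomial. -/
lemma SolvesRHP.exists_polynomial {q α β : ℝ} (hq0 : 0 < q) (hq1 : q < 1) (hα : -1 < α)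
    (hβ : -1 < β) {hA hB : ℂ → ℂ} (hhA : IsQPeriodicKernel q α hA) (hhB : IsQPeriodicKernel q β hB)
    {n : ℕ} {Γ : Set ℂ} (hΓ : IsAppropriateCurve q Γ) {Y : ℂ → Matrix (Fin 3) (Fin 3) ℂ}
    (hY : SolvesRHP q hA hB n Γ Y) (i : Fin 3) {d : ℕ}
    (hd : (fun z => Y z i 0) =O[Bornology.cobounded ℂ] fun z => z ^ d) :
    ∃ P : Polynomial ℂ, P.natDegree ≤ d ∧ (∀ z ∉ Γ, Y z i 0 = P.eval z) ∧
      (∀ j < n, jacksonIntegral q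
        (fun x => P.eval (x : ℂ) * (x : ℂ) ^ j * littleJacobiWeight q α x) =
          if j + 1 = n then (1 : Matrix (Fin 3) (Fin 3) ℂ) i 1 else 0) ∧
      (∀ j < n, jacksonIntegral q
        (fun x => P.eval (x : ℂ) * (x : ℂ) ^ j * littleJacobiWeight q β x) =
          if j + 1 = n then (1 : Matrix (Fin 3) (Fin 3) ℂ) i 2 else 0) := by
  obtain ⟨Ym, Yp, hYm, hYp, hjump⟩ := hY.jump
  have hcpt := hΓ.jordan.isCompact
  have hent : ∀ {F : ℂ → Matrix (Fin 3) (Fin 3) ℂ} {l : Filter ℂ} {A : Matrix (Fin 3) (Fin 3) ℂ}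
      (k : Fin 3), Tendsto F l (𝓝 A) → Tendsto (fun z => F z i k) l (𝓝 (A i k)) :=
    fun k h => tendsto_pi_nhds.1 (tendsto_pi_nhds.1 h i) k
  have hcont : ∀ {F : ℂ → Matrix (Fin 3) (Fin 3) ℂ} (k : Fin 3), ContinuousOn F Γ →
      ContinuousOn (fun z => F z i k) Γ := fun k h s hs => hent k (h s hs)
  have hdiff : ∀ k, ∀ z, z ∉ Γ → DifferentiableAt ℂ (fun z => Y z i k) z := fun k z hz =>
    (hY.analytic i k).differentiableAt (hcpt.isClosed.isOpen_compl.mem_nhds hz)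
  have h0 : ∀ s ∈ Γ, Yp s i 0 = Ym s i 0 := fun s hs => by
    rw [(hjump s hs).2.2, Matrix.mul_apply, Fin.sum_univ_three]
    simp [jumpMatrix]
  have h1 : ∀ s ∈ Γ, Yp s i 1 = Ym s i 1 + qPochInf q (q * s) * hA s * Ym s i 0 := fun s hs => by
    rw [(hjump s hs).2.2, Matrix.mul_apply, Fin.sum_univ_three]
    simp [jumpMatrix]
    ring
  have h2 : ∀ s ∈ Γ, Yp s i 2 = Ym s i 2 + qPochInf q (q * s) * hB s * Ym s i 0 := fun s hs => by
    rw [(hjump s hs).2.2, Matrix.mul_apply, Fin.sum_univ_three]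
    simp [jumpMatrix]
    ring
  set f := glueAcross Γ (fun z => Y z i 0) (fun z => Y z i 0) (fun z => Ym z i 0) with hf
  have hfY : ∀ z ∉ Γ, f z = Y z i 0 := fun z hz => by
    rcases mem_curveInterior_or_curveExterior hz with h | h
    · exact glueAcross_of_mem_interior h
    · exact glueAcross_of_mem_exterior h
  have hfd : Differentiable ℂ f := by
    rw [← differentiableOn_univ]
    refine differentiableOn_glueAcross hΓ.jordan isOpen_univ (hcont 0 hYm)
      (fun z _ hz => hdiff 0 z hz.1) (fun z _ hz => hdiff 0 z hz.1)
      (fun s hs => hent 0 (hjump s hs).1) (fun s hs => ?_)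
    have := hent 0 (hjump s hs).2.1
    rwa [h0 s hs] at this
  have hfO : f =O[Bornology.cobounded ℂ] fun z => z ^ d := by
    refine hd.congr' ?_ (EventuallyEq.refl _ _)
    filter_upwards [eventually_mem_curveExterior hcpt.isBounded] with z hz using (hfY z hz.1).symm
  obtain ⟨P, hPd, hP⟩ := exists_polynomial_of_isBigO hfd hfO
  -- The boundary values on `Γ` are those of `P`, because `f` was given the value `Ym` there.
  have hPm : ∀ s ∈ Γ, Ym s i 0 = P.eval s := fun s hs => by
    rw [← hP, hf, glueAcross_of_mem hs]
  refine ⟨P, hPd, fun z hz => by rw [← hP, hfY z hz], fun j hj => ?_, fun j hj => ?_⟩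
  · refine jacksonIntegral_eq_of_jump hq0 hq1 hα hhA hΓ P (hY.analytic i 1) (hcont 1 hYp)
      (fun s hs => hent 1 (hjump s hs).1) (fun s hs => hent 1 (hjump s hs).2.1)
      (fun s hs => by rw [h1 s hs, hPm s hs]) j (isBigO_mul_pow_sub_inv ?_ hj)
    have := hY.decay i 1
    simpa only [Matrix.sub_apply, Matrix.mul_diagonal, Matrix.cons_val_one, Matrix.cons_val_zero]
      using this
  · refine jacksonIntegral_eq_of_jump hq0 hq1 hβ hhB hΓ P (hY.analytic i 2) (hcont 2 hYp)
      (fun s hs => hent 2 (hjump s hs).1) (fun s hs => hent 2 (hjump s hs).2.1)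
      (fun s hs => by rw [h2 s hs, hPm s hs]) j (isBigO_mul_pow_sub_inv ?_ hj)
    have := hY.decay i 2
    simpa only [Matrix.sub_apply, Matrix.mul_diagonal, Matrix.cons_val] using this

/-- The normalisation at infinity, read off in the first column. -/
lemma SolvesRHP.first_column_isBigO {q : ℝ} {hA hB : ℂ → ℂ} {n : ℕ} (hn : 1 ≤ n) {Γ : Set ℂ}
    {Y : ℂ → Matrix (Fin 3) (Fin 3) ℂ} (hY : SolvesRHP q hA hB n Γ Y) (i : Fin 3) :
    (fun z => Y z i 0 - (1 : Matrix (Fin 3) (Fin 3) ℂ) i 0 * z ^ (2 * n))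
      =O[Bornology.cobounded ℂ] fun z => z ^ (2 * n - 1) := by
  have h : (fun z => Y z i 0 * z ^ (-(2 * (n : ℤ))) - (1 : Matrix (Fin 3) (Fin 3) ℂ) i 0)
      =O[Bornology.cobounded ℂ] fun z => z⁻¹ := by
    simpa only [Matrix.sub_apply, Matrix.mul_diagonal, Matrix.cons_val_zero] using hY.decay i 0
  have hne : ∀ᶠ z : ℂ in Bornology.cobounded ℂ, 1 ≤ ‖z‖ := eventually_cobounded_le_norm 1
  obtain ⟨m, rfl⟩ : ∃ m, n = m + 1 := ⟨n - 1, by omega⟩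
  refine (h.mul (Asymptotics.isBigO_refl (fun z : ℂ => z ^ (2 * (m + 1))) _)).congr' ?_ ?_
  · filter_upwards [hne] with z hz
    have hz0 : z ≠ 0 := norm_pos_iff.1 (by linarith)
    have e : z ^ (-(2 * ((m + 1 : ℕ) : ℤ))) * z ^ (2 * (m + 1)) = 1 := by
      rw [← zpow_natCast z, ← zpow_add₀ hz0]
      simp
    rw [sub_mul, mul_assoc, e, mul_one]
  · filter_upwards [hne] with z hz
    have hz0 : z ≠ 0 := norm_pos_iff.1 (by linarith)
    have e : 2 * (m + 1) - 1 = 2 * m + 1 := by omega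
    have e' : 2 * (m + 1) = 2 * m + 1 + 1 := by ring
    rw [e, e', pow_succ z (2 * m + 1)]
    field_simp

/-- The `(1, 1)` entry of a solution is the diagonal multiple orthogonal polynomial. -/
lemma SolvesRHP.exists_isMultipleOrthogonal {q α β : ℝ} (hq0 : 0 < q) (hq1 : q < 1) (hα : -1 < α)
    (hβ : -1 < β) {hA hB : ℂ → ℂ} (hhA : IsQPeriodicKernel q α hA) (hhB : IsQPeriodicKernel q β hB)
    {n : ℕ} (hn : 1 ≤ n) {Γ : Set ℂ} (hΓ : IsAppropriateCurve q Γ)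
    {Y : ℂ → Matrix (Fin 3) (Fin 3) ℂ} (hY : SolvesRHP q hA hB n Γ Y) :
    ∃ P : Polynomial ℂ,
      IsMultipleOrthogonal q (littleJacobiWeight q α) (littleJacobiWeight q β) n n P ∧
      ∀ z ∉ Γ, Y z 0 0 = P.eval z := by
  have hne : ∀ᶠ z : ℂ in Bornology.cobounded ℂ, 1 ≤ ‖z‖ := eventually_cobounded_le_norm 1
  have h0 := hY.first_column_isBigO hn 0
  simp only [Matrix.one_apply_eq, one_mul] at h0
  have hle : (fun z : ℂ => z ^ (2 * n - 1)) =O[Bornology.cobounded ℂ] fun z => z ^ (2 * n) := by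
    refine Asymptotics.IsBigO.of_bound 1 ?_
    filter_upwards [hne] with z hz
    rw [norm_pow, norm_pow, one_mul]
    exact pow_le_pow_right₀ hz (by omega)
  have hO : (fun z => Y z 0 0) =O[Bornology.cobounded ℂ] fun z => z ^ (2 * n) := by
    have := (h0.trans hle).add (Asymptotics.isBigO_refl (fun z : ℂ => z ^ (2 * n)) _)
    simpa using this
  obtain ⟨P, -, hPY, hP1, hP2⟩ := hY.exists_polynomial hq0 hq1 hα hβ hhA hhB hΓ 0 hO
  have hQO : (fun z : ℂ => (P - Polynomial.X ^ (2 * n)).eval z) =O[Bornology.cobounded ℂ]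
      fun z => z ^ (2 * n - 1) := by
    refine h0.congr' ?_ (EventuallyEq.refl _ _)
    filter_upwards [eventually_mem_curveExterior hΓ.jordan.isCompact.isBounded] with z hz
    rw [hPY z hz.1]
    simp
  obtain ⟨Q, hQd, hQ⟩ := exists_polynomial_of_isBigO (Polynomial.differentiable _) hQO
  have hPQ : P = Polynomial.X ^ (2 * n) + Q := by
    rw [← Polynomial.funext hQ]
    ring
  have hQlt : Q.degree < (2 * n : ℕ) :=
    by
    refine Polynomial.degree_le_natDegree.trans_lt ?_
    exact_mod_cast (by omega : Q.natDegree < 2 * n)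
  refine ⟨P, ⟨?_, ?_, fun k hk => ?_, fun k hk => ?_⟩, hPY⟩
  · rw [hPQ]; exact Polynomial.monic_X_pow_add hQlt
  · rw [hPQ, Polynomial.natDegree_add_eq_left_of_natDegree_lt, Polynomial.natDegree_X_pow, two_mul]
    rw [Polynomial.natDegree_X_pow]
    omega
  · rw [hP1 k hk]; simp
  · rw [hP2 k hk]; simp

end RHP

lemma jacksonIntegral_C_mul (q α : ℝ) (c : ℂ) (P : Polynomial ℂ) (i : ℕ) :
    jacksonIntegral q
      (fun x => (Polynomial.C c * P).eval (x : ℂ) * (x : ℂ) ^ i * littleJacobiWeight q α x) =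
    c * jacksonIntegral q
      (fun x => P.eval (x : ℂ) * (x : ℂ) ^ i * littleJacobiWeight q α x) := by
  rw [jacksonIntegral, jacksonIntegral, ← tsum_mul_left]
  refine tsum_congr fun k => ?_
  rw [Polynomial.eval_mul, Polynomial.eval_C]
  ring

end

theorem mainTheorem2 (q α β : ℝ) (hq0 : 0 < q) (hq1 : q < 1) (hα : -1 < α) (hβ : -1 < β)
    (hαβ : ∀ k : ℤ, α - β ≠ k) (n : ℕ) (hn : 1 ≤ n) :
    -- the three monic multiple orthogonal polynomials exist and are unique
    (∃! P : Polynomial ℂ,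
      IsMultipleOrthogonal q (littleJacobiWeight q α) (littleJacobiWeight q β) n n P) ∧
    (∃! P : Polynomial ℂ,
      IsMultipleOrthogonal q (littleJacobiWeight q α) (littleJacobiWeight q β) (n - 1) n P) ∧
    (∃! P : Polynomial ℂ,
      IsMultipleOrthogonal q (littleJacobiWeight q α) (littleJacobiWeight q β) n (n - 1) P) ∧
    ∀ P₁ P₂ P₃ : Polynomial ℂ,
      IsMultipleOrthogonal q (littleJacobiWeight q α) (littleJacobiWeight q β) n n P₁ →
      IsMultipleOrthogonal q (littleJacobiWeight q α) (littleJacobiWeight q β) (n - 1) n P₂ →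
      IsMultipleOrthogonal q (littleJacobiWeight q α) (littleJacobiWeight q β) n (n - 1) P₃ →
      ∀ γ₁ γ₂ : ℂ,
      γ₁ = jacksonIntegral q
        (fun x => P₂.eval (x : ℂ) * (x : ℂ) ^ (n - 1) * littleJacobiWeight q α x) →
      γ₂ = jacksonIntegral q
        (fun x => P₃.eval (x : ℂ) * (x : ℂ) ^ (n - 1) * littleJacobiWeight q β x) →
      ∀ Y₁₁ Y₂₁ Y₃₁ : ℂ → ℂ,
      (∀ z, Y₁₁ z = P₁.eval z) →
      (∀ z, Y₂₁ z = 1 / γ₁ * P₂.eval z) →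
      (∀ z, Y₃₁ z = 1 / γ₂ * P₃.eval z) →
      ∀ a b : ℂ, a = ((q ^ α : ℝ) : ℂ) → b = ((q ^ β : ℝ) : ℂ) →
      γ₁ ≠ 0 ∧ γ₂ ≠ 0 ∧
      -- away from the contour, these are the first-column entries of every solution of the
      -- Riemann-Hilbert problem
      ((∀ k : ℤ, α ≠ k) → (∀ k : ℤ, β ≠ k) →
        ∀ (hA hB : ℂ → ℂ) (Γ : Set ℂ) (Y : ℂ → Matrix (Fin 3) (Fin 3) ℂ),
          IsQPeriodicKernel q α hA → IsQPeriodicKernel q β hB → IsAppropriateCurve q Γ →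
          SolvesRHP q hA hB n Γ Y →
          ∀ z ∉ Γ, Y z 0 0 = Y₁₁ z ∧ Y z 1 0 = Y₂₁ z ∧ Y z 2 0 = Y₃₁ z) ∧
      -- the three `q`-difference equations
      (∀ y : ℂ → ℂ, y = rescaledEntry q n Y₁₁ → ∀ t : ℂ,
        y t = (1 + a + b - q * t) * y (q * t)
          + (-(a + b + a * b) + (a + b) * (q : ℂ) ^ (n + 2) * t) * y ((q : ℂ) ^ 2 * t)
          + (a * b - (q : ℂ) ^ (3 + 2 * n) * a * b * t) * y ((q : ℂ) ^ 3 * t)) ∧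
      (∀ y : ℂ → ℂ, y = rescaledEntry q n Y₂₁ → ∀ t : ℂ,
        y t = (1 + a + b - (q : ℂ) ^ 2 * t) * y (q * t)
          + (-(a + b + a * b) + (a + b * q) * (q : ℂ) ^ (n + 2) * t) * y ((q : ℂ) ^ 2 * t)
          + (a * b - (q : ℂ) ^ (3 + 2 * n) * a * b * t) * y ((q : ℂ) ^ 3 * t)) ∧
      (∀ y : ℂ → ℂ, y = rescaledEntry q n Y₃₁ → ∀ t : ℂ,
        y t = (1 + a + b - (q : ℂ) ^ 2 * t) * y (q * t)
          + (-(a + b + a * b) + (a * q + b) * (q : ℂ) ^ (n + 2) * t) * y ((q : ℂ) ^ 2 * t)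
          + (a * b - (q : ℂ) ^ (3 + 2 * n) * a * b * t) * y ((q : ℂ) ^ 3 * t)) := by
  have hαβ' : ∀ k : ℤ, β - α ≠ k := fun k hk => hαβ (-k) (by push_cast; linarith)
  have hqc : (q : ℂ) ≠ 0 := by exact_mod_cast hq0.ne'
  refine ⟨existsUnique_isMultipleOrthogonal hq0 hq1 hα hβ hαβ n n,
    existsUnique_isMultipleOrthogonal hq0 hq1 hα hβ hαβ (n - 1) n,
    existsUnique_isMultipleOrthogonal hq0 hq1 hα hβ hαβ n (n - 1), ?_⟩
  intro P₁ P₂ P₃ hP₁ hP₂ hP₃ γ₁ γ₂ hγ₁ hγ₂ Y₁₁ Y₂₁ Y₃₁ hY₁ hY₂ hY₃ a b ha hb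
  have hγ₁0 : γ₁ ≠ 0 := hγ₁ ▸ jacksonIntegral_ne_zero hq0 hq1 hα hβ hαβ hP₂
  have hγ₂0 : γ₂ ≠ 0 := hγ₂ ▸ jacksonIntegral_ne_zero hq0 hq1 hβ hα hαβ' hP₃.symm
  refine ⟨hγ₁0, hγ₂0, ?_, ?_, ?_, ?_⟩
  · intro _ _ hA hB Γ Y hhA hhB hΓ hY z hz
    refine ⟨?_, ?_, ?_⟩
    · obtain ⟨P, hP, hPY⟩ := hY.exists_isMultipleOrthogonal hq0 hq1 hα hβ hhA hhB hn hΓ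
      rw [hPY z hz, hY₁,
        (existsUnique_isMultipleOrthogonal hq0 hq1 hα hβ hαβ n n).unique hP hP₁]
    · have hO := hY.first_column_isBigO hn 1
      simp only [ne_eq, one_ne_zero, not_false_eq_true, Matrix.one_apply_ne, zero_mul,
        sub_zero] at hO
      obtain ⟨P, hPd, hPY, hPα, hPβ⟩ := hY.exists_polynomial hq0 hq1 hα hβ hhA hhB hΓ 1 hO
      have hPc := eq_C_mul_of_orthogonal hq0 hq1 hα hβ hαβ hP₂ (Q := P) (by omega)
        (fun i hi => by rw [hPα i (by omega), if_neg (by omega)])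
        (fun j hj => by rw [hPβ j hj]; simp)
      have h1 := hPα (n - 1) (by omega)
      rw [if_pos (by omega), Matrix.one_apply_eq, hPc, jacksonIntegral_C_mul, ← hγ₁] at h1
      rw [hPY z hz, hY₂, hPc, Polynomial.eval_mul, Polynomial.eval_C, eq_div_of_mul_eq hγ₁0 h1]
    · have hO := hY.first_column_isBigO hn 2
      simp only [ne_eq, Fin.reduceEq, not_false_eq_true, Matrix.one_apply_ne, zero_mul,
        sub_zero] at hO
      obtain ⟨P, hPd, hPY, hPα, hPβ⟩ := hY.exists_polynomial hq0 hq1 hα hβ hhA hhB hΓ 2 hO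
      have hPc := eq_C_mul_of_orthogonal hq0 hq1 hα hβ hαβ hP₃ (Q := P) (by omega)
        (fun i hi => by rw [hPα i hi]; simp)
        (fun j hj => by rw [hPβ j (by omega), if_neg (by omega)])
      have h1 := hPβ (n - 1) (by omega)
      rw [if_pos (by omega), Matrix.one_apply_eq, hPc, jacksonIntegral_C_mul, ← hγ₂] at h1
      rw [hPY z hz, hY₃, hPc, Polynomial.eval_mul, Polynomial.eval_C, eq_div_of_mul_eq hγ₂0 h1]
  · rintro y rfl t
    have h := hP₁.rescaledEntry_qDifference hq0 hq1 hα hβ hαβ (n := n) ha hb (f := Y₁₁) (d := 1)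
      (fun z => by rw [hY₁, one_mul]) t
    refine mul_left_cancel₀ (pow_ne_zero (n + n) hqc) ?_
    linear_combination h
  · obtain ⟨m, rfl⟩ : ∃ m, n = m + 1 := ⟨n - 1, by omega⟩
    rintro y rfl t
    have h := hP₂.rescaledEntry_qDifference hq0 hq1 hα hβ hαβ (n := m + 1) ha hb (f := Y₂₁) hY₂ t
    refine mul_left_cancel₀ (pow_ne_zero (m + 1 - 1 + (m + 1)) hqc) ?_
    rw [Nat.add_sub_cancel] at h ⊢
    linear_combination h
  · obtain ⟨m, rfl⟩ : ∃ m, n = m + 1 := ⟨n - 1, by omega⟩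
    rintro y rfl t
    have h := hP₃.rescaledEntry_qDifference hq0 hq1 hα hβ hαβ (n := m + 1) ha hb (f := Y₃₁) hY₃ t
    refine mul_left_cancel₀ (pow_ne_zero (m + 1 + (m + 1 - 1)) hqc) ?_
    rw [Nat.add_sub_cancel] at h ⊢
    linear_combination h
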